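/- Let $n\ge 1$ be an integer and let $\hbar,m>0$. Let $L^2(\mathcal G)=\bigoplus_{\ell=1}^n L^2(\mathbb R_+)$, $\mathbb R_+=(0,\infty)$, be the complex Hilbert space of the star-graph with $n$ edges, and let $H^2(\mathcal G)=\bigoplus_{\ell=1}^n H^2(\mathbb R_+)$. Let $H_K$ and $H_D^{\oplus}$ be the operators in $L^2(\mathcal G)$ acting as $\boldsymbol\psi\mapsto-\frac{\hbar^2}{2m}\boldsymbol\psi''$ on the domains $$\operatorname{dom}(H_K)=\Big\{\boldsymbol\psi\in H^2(\mathcal G)\;:\;\psi_1(0)=\dots=\psi_n(0),\ \sum_{\ell=1}^n\psi_\ell'(0)=0\Big\},\qquad \operatorname{dom}(H_D^{\oplus})=\big\{\boldsymbol\psi\in H^2(\mathcal G)\;:\;\psi_1(0)=\dots=\psi_n(0)=0\big\}.$$ Then the strongly continuous unitary groups $e^{-i\frac t\hbar H_K}$ and $e^{-i\frac t\hbar H_D^{\oplus}}$ ($t\in\mathbb R$), with infinitesimal generators $-\frac i\hbar H_K$ and $-\frac i\hbar H_D^{\oplus}$, exist and are unique. Likewise there are unique unitary operators $\mathcal F_s,\mathcal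 F_c$ on $L^2(\mathbb R_+)$ such that, for $\psi\in L^1(\mathbb R_+)\cap L^2(\mathbb R_+)$ and almost every $k\in\mathbb R_+$, $$(\mathcal F_s\psi)(k)=-\frac{2i}{\sqrt{2\pi}}\int_0^\infty \sin(kx)\,\psi(x)\,dx,\qquad (\mathcal F_c\psi)(k)=\frac{2}{\sqrt{2\pi}}\int_0^\infty\cos(kx)\,\psi(x)\,dx .$$ Let $\mathbb S=\mathbf 1-\frac2n J$, where $J$ is the $n\times n$ all-ones matrix, i.e. $(\mathbb S)_{\ell\ell'}=\delta_{\ell\ell'}-\frac2n$; let $\mathbb S$ also denote the operator $(\mathbb S\boldsymbol\psi)_\ell=\sum_{\ell'=1}^n(\mathbb S)_{\ell\ell'}\psi_{\ell'}$ on $L^2(\mathcal G)$. Then the quantum wave operators $$\Omega^{\pm}:=\operatorname*{s-lim}_{t\to\pm\infty}e^{i\frac t\hbar H_K}\,e^{-i\frac t\hbar H_D^{\oplus}}$$ exist and are given by $$\Omega^{\pm}=\frac12\bigoplus_{\ell=1}^n\big(\mathbf 1\pm\mathcal F_c^*\mathcal F_s\big)+\frac12\,\mathbb S\bigoplus_{\ell=1}^n\big(\mathbf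 1\mp\mathcal F_c^*\mathcal F_s\big).$$ Consequently the scattering operator $S:=(\Omega^+)^*\,\Omega^-$ is $S=\mathbb S$, that is, $(S\boldsymbol\psi)_\ell=\sum_{\ell'=1}^n\big(\delta_{\ell\ell'}-\frac2n\big)\psi_{\ell'}$ for all $\boldsymbol\psi\in L^2(\mathcal G)$ and $\ell=1,\dots,n$. -/

import Mathlib

open MeasureTheory Filter Topology Set
open scoped ContDiff InnerProduct

noncomputable section

namespace StarGraph

/-! ### The Hilbert spaces -/

/-- Lebesgue measure on the half-line `ℝ₊ = (0, ∞)`. -/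
abbrev halfLine : Measure ℝ := volume.restrict (Ioi (0 : ℝ))

/-- `L²(ℝ₊)`, complex valued. -/
abbrev L2Half : Type := Lp ℂ 2 halfLine

/-- `L²(𝒢) = ⊕_{ℓ=1}^n L²(ℝ₊)`, the Hilbert space of the star-graph with `n` edges. -/
abbrev L2Graph (n : ℕ) : Type := PiLp 2 (fun _ : Fin n => L2Half)

/-- The identification of `L²(𝒢)` with tuples of elements of `L²(ℝ₊)`. -/
abbrev coords (n : ℕ) : L2Graph n ≃L[ℂ] (Fin n → L2Half) :=
  PiLp.continuousLinearEquiv 2 ℂ (fun _ : Fin n => L2Half)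

/-! ### Weak derivatives and boundary values on the half-line -/

/-- `g ∈ L²(ℝ₊)` is the weak derivative of `f ∈ L²(ℝ₊)`, tested on `C_c^∞((0, ∞))`. -/
def IsWeakDeriv (f g : L2Half) : Prop :=
  ∀ φ : ℝ → ℝ, ContDiff ℝ ∞ φ → HasCompactSupport φ → tsupport φ ⊆ Ioi (0 : ℝ) →
    ∫ x, deriv φ x • f x ∂halfLine = - ∫ x, φ x • g x ∂halfLine

/-- `f` has a representative that is continuous on `[0, ∞)`, and its value at `0` is `a`. -/
def HasTrace (f : L2Half) (a : ℂ) : Prop :=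
  ∃ u : ℝ → ℂ, ContinuousOn u (Ici (0 : ℝ)) ∧ f =ᵐ[halfLine] u ∧ u 0 = a

theorem integrable_test_smul {φ : ℝ → ℝ} (hφ : Continuous φ) (hc : HasCompactSupport φ)
    (f : L2Half) : Integrable (fun x => φ x • f x) halfLine :=
  memLp_one_iff_integrable.1 ((Lp.memLp f).smul (p := 2) (q := 2) (r := 1)
    ((hφ.memLp_of_hasCompactSupport hc (μ := volume)).restrict _))

theorem IsWeakDeriv.zero : IsWeakDeriv 0 0 := by
  intro φ _ _ _
  have h : ∀ ρ : ℝ → ℝ, ∫ x, ρ x • (0 : L2Half) x ∂halfLine = 0 := by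
    intro ρ
    apply integral_eq_zero_of_ae
    filter_upwards [Lp.coeFn_zero ℂ 2 halfLine] with x hx
    rw [hx, Pi.zero_apply, smul_zero]
  rw [h, h, neg_zero]

theorem IsWeakDeriv.add {f g f' g' : L2Half} (hf : IsWeakDeriv f f') (hg : IsWeakDeriv g g') :
    IsWeakDeriv (f + g) (f' + g') := by
  intro φ h1 h2 h3
  have key : ∀ (ρ : ℝ → ℝ) (a b : L2Half), Continuous ρ → HasCompactSupport ρ →
      ∫ x, ρ x • (a + b : L2Half) x ∂halfLine
        = ∫ x, ρ x • a x ∂halfLine + ∫ x, ρ x • b x ∂halfLine := by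
    intro ρ a b hρ hc
    rw [← integral_add (integrable_test_smul hρ hc a) (integrable_test_smul hρ hc b)]
    apply integral_congr_ae
    filter_upwards [Lp.coeFn_add a b] with x hx
    simp only [hx, Pi.add_apply, smul_add]
  rw [key _ _ _ (h1.continuous_deriv (by simp)) h2.deriv, key _ _ _ h1.continuous h2,
    hf φ h1 h2 h3, hg φ h1 h2 h3]
  ring

theorem IsWeakDeriv.smul {f f' : L2Half} (c : ℂ) (hf : IsWeakDeriv f f') :
    IsWeakDeriv (c • f) (c • f') := by
  intro φ h1 h2 h3
  have key : ∀ (ρ : ℝ → ℝ) (a : L2Half),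
      ∫ x, ρ x • (c • a : L2Half) x ∂halfLine = c • ∫ x, ρ x • a x ∂halfLine := by
    intro ρ a
    rw [← integral_smul]
    apply integral_congr_ae
    filter_upwards [Lp.coeFn_smul c a] with x hx
    simp only [hx, Pi.smul_apply]
    exact smul_comm _ _ _
  rw [key, key, hf φ h1 h2 h3, smul_neg]

/-- Weak derivatives are unique. -/
theorem IsWeakDeriv.unique_zero {g : L2Half} (hg : IsWeakDeriv 0 g) : g = 0 := by
  have h : ∀ᵐ x ∂(volume : Measure ℝ), x ∈ Ioi (0 : ℝ) → g x = 0 := by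
    apply isOpen_Ioi.ae_eq_zero_of_integral_contDiff_smul_eq_zero
    · apply locallyIntegrableOn_of_locallyIntegrable_restrict
      exact (Lp.memLp g).locallyIntegrable (by norm_num)
    · intro φ h1 h2 h3
      have h0 : ∫ x, deriv φ x • (0 : L2Half) x ∂halfLine = 0 := by
        apply integral_eq_zero_of_ae
        filter_upwards [Lp.coeFn_zero ℂ 2 halfLine] with x hx
        rw [hx, Pi.zero_apply, smul_zero]
      have h4 := hg φ h1 h2 h3
      rw [h0, zero_eq_neg] at h4
      rw [← h4]
      symm
      apply setIntegral_eq_integral_of_forall_compl_eq_zero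
      intro x hx
      have : φ x = 0 := by
        by_contra hne
        exact hx (h3 (subset_tsupport _ hne))
      simp [this]
  apply Lp.ext
  have h' : ∀ᵐ x ∂halfLine, g x = 0 := (ae_restrict_iff' measurableSet_Ioi).2 h
  filter_upwards [h', Lp.coeFn_zero ℂ 2 halfLine] with x hx h0
  rw [hx, h0, Pi.zero_apply]

theorem HasTrace.zero : HasTrace 0 0 :=
  ⟨fun _ => 0, continuousOn_const, Lp.coeFn_zero ℂ 2 halfLine, rfl⟩

theorem HasTrace.add {f g : L2Half} {a b : ℂ} (hf : HasTrace f a) (hg : HasTrace g b) :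
    HasTrace (f + g) (a + b) := by
  obtain ⟨u, hu, hfu, rfl⟩ := hf
  obtain ⟨v, hv, hgv, rfl⟩ := hg
  exact ⟨u + v, hu.add hv, (Lp.coeFn_add f g).trans (hfu.add hgv), rfl⟩

theorem HasTrace.smul {f : L2Half} {a : ℂ} (c : ℂ) (hf : HasTrace f a) :
    HasTrace (c • f) (c • a) := by
  obtain ⟨u, hu, hfu, rfl⟩ := hf
  exact ⟨c • u, hu.const_smul c, (Lp.coeFn_smul c f).trans (hfu.const_smul c), rfl⟩

/-! ### The Hamiltonians -/

/-- The graph of `ψ ↦ -(ħ²/2m) ψ''` with domain the `ψ ∈ H²(𝒢)` whose boundary values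
`(ψ(0), ψ'(0)) ∈ ℂⁿ × ℂⁿ` lie in the subspace `B`. Here `ψ ∈ H²(𝒢)` means that all components
have weak derivatives `ψ'`, `ψ''` in `L²(ℝ₊)`. -/
def hamiltonianGraph (n : ℕ) (ħ m : ℝ) (B : Submodule ℂ ((Fin n → ℂ) × (Fin n → ℂ))) :
    Submodule ℂ (L2Graph n × L2Graph n) where
  carrier := {p | ∃ (ψ' ψ'' : L2Graph n) (a b : Fin n → ℂ),
    (∀ ℓ, IsWeakDeriv (p.1 ℓ) (ψ' ℓ)) ∧ (∀ ℓ, IsWeakDeriv (ψ' ℓ) (ψ'' ℓ)) ∧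
    (∀ ℓ, HasTrace (p.1 ℓ) (a ℓ)) ∧ (∀ ℓ, HasTrace (ψ' ℓ) (b ℓ)) ∧ (a, b) ∈ B ∧
    p.2 = (-(ħ ^ 2 / (2 * m) : ℝ) : ℂ) • ψ''}
  zero_mem' := ⟨0, 0, 0, 0, fun _ => IsWeakDeriv.zero, fun _ => IsWeakDeriv.zero,
    fun _ => HasTrace.zero, fun _ => HasTrace.zero, B.zero_mem, by simp⟩
  add_mem' := by
    rintro p q ⟨p', p'', a, b, h1, h2, h3, h4, h5, h6⟩ ⟨q', q'', c, d, k1, k2, k3, k4, k5, k6⟩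
    exact ⟨p' + q', p'' + q'', a + c, b + d, fun ℓ => (h1 ℓ).add (k1 ℓ),
      fun ℓ => (h2 ℓ).add (k2 ℓ), fun ℓ => (h3 ℓ).add (k3 ℓ), fun ℓ => (h4 ℓ).add (k4 ℓ),
      B.add_mem h5 k5, by rw [Prod.snd_add, h6, k6, smul_add]⟩
  smul_mem' := by
    rintro c p ⟨p', p'', a, b, h1, h2, h3, h4, h5, h6⟩
    exact ⟨c • p', c • p'', c • a, c • b, fun ℓ => (h1 ℓ).smul c, fun ℓ => (h2 ℓ).smul c,
      fun ℓ => (h3 ℓ).smul c, fun ℓ => (h4 ℓ).smul c, B.smul_mem c h5,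
      by rw [Prod.smul_snd, h6, smul_comm]⟩

/-- The operator `ψ ↦ -(ħ²/2m) ψ''` in `L²(𝒢)` with the boundary conditions `B`. -/
def hamiltonian (n : ℕ) (ħ m : ℝ) (B : Submodule ℂ ((Fin n → ℂ) × (Fin n → ℂ))) :
    L2Graph n →ₗ.[ℂ] L2Graph n :=
  (hamiltonianGraph n ħ m B).toLinearPMap

/-- `hamiltonianGraph` is single valued, so it is the graph of `hamiltonian`. -/
theorem hamiltonian_graph (n : ℕ) (ħ m : ℝ) (B : Submodule ℂ ((Fin n → ℂ) × (Fin n → ℂ))) :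
    (hamiltonian n ħ m B).graph = hamiltonianGraph n ħ m B := by
  apply Submodule.toLinearPMap_graph_eq
  rintro ⟨p, q⟩ ⟨ψ', ψ'', a, b, h1, h2, -, -, -, h6⟩ hp
  simp only at hp h1 h6
  subst hp
  have e1 : ∀ ℓ, ψ' ℓ = 0 := fun ℓ => IsWeakDeriv.unique_zero (h1 ℓ)
  have e2 : ψ'' = 0 := by
    ext1 ℓ
    exact IsWeakDeriv.unique_zero (e1 ℓ ▸ h2 ℓ)
  simp [h6, e2]

/-- Kirchhoff conditions: `ψ₁(0) = … = ψₙ(0)` and `∑ ψ'_ℓ(0) = 0`. -/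
def kirchhoffCondition (n : ℕ) : Submodule ℂ ((Fin n → ℂ) × (Fin n → ℂ)) where
  carrier := {p | (∀ ℓ ℓ', p.1 ℓ = p.1 ℓ') ∧ ∑ ℓ, p.2 ℓ = 0}
  zero_mem' := by simp
  add_mem' := by
    rintro p q ⟨h1, h2⟩ ⟨k1, k2⟩
    refine ⟨fun ℓ ℓ' => ?_, ?_⟩
    · simp [h1 ℓ ℓ', k1 ℓ ℓ']
    · simp [Finset.sum_add_distrib, h2, k2]
  smul_mem' := by
    rintro c p ⟨h1, h2⟩
    refine ⟨fun ℓ ℓ' => ?_, ?_⟩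
    · simp [h1 ℓ ℓ']
    · simp [← Finset.mul_sum, h2]

/-- Dirichlet conditions: `ψ₁(0) = … = ψₙ(0) = 0`. -/
def dirichletCondition (n : ℕ) : Submodule ℂ ((Fin n → ℂ) × (Fin n → ℂ)) where
  carrier := {p | ∀ ℓ, p.1 ℓ = 0}
  zero_mem' := by simp
  add_mem' := by
    intro p q h k ℓ
    simp [h ℓ, k ℓ]
  smul_mem' := by
    intro c p h ℓ
    simp [h ℓ]

/-- The Kirchhoff Hamiltonian `H_K`. -/
def kirchhoffHamiltonian (n : ℕ) (ħ m : ℝ) : L2Graph n →ₗ.[ℂ] L2Graph n :=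
  hamiltonian n ħ m (kirchhoffCondition n)

/-- The Dirichlet Hamiltonian `H_D^⊕`. -/
def dirichletHamiltonian (n : ℕ) (ħ m : ℝ) : L2Graph n →ₗ.[ℂ] L2Graph n :=
  hamiltonian n ħ m (dirichletCondition n)

/-! ### Unitary groups and wave operators -/

section Scattering

variable {E : Type*} [NormedAddCommGroup E] [InnerProductSpace ℂ E] [CompleteSpace E]

/-- `U t = e^{-i t H / ħ}` in the sense of Stone's theorem: `U` is the strongly continuous
one-parameter unitary group with infinitesimal generator exactly `-i H / ħ` (same domain). -/
structure IsUnitaryGroup (ħ : ℝ) (H : E →ₗ.[ℂ] E) (U : ℝ → E →L[ℂ] E) : Prop where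
  unitary : ∀ t, U t ∈ unitary (E →L[ℂ] E)
  zero : U 0 = 1
  add : ∀ s t, U (s + t) = U s ∘L U t
  continuous : ∀ ψ, Continuous fun t => U t ψ
  generator : ∀ ψ η, (ψ, η) ∈ H.graph ↔
    HasDerivAt (fun t => U t ψ) ((-(Complex.I / (ħ : ℂ))) • η) 0

/-- The group `t ↦ e^{-i t H / ħ}`; meaningful whenever `IsUnitaryGroup ħ H` is satisfied by
some family, which is then unique. -/
def unitaryGroup (ħ : ℝ) (H : E →ₗ.[ℂ] E) : ℝ → E →L[ℂ] E :=
  Classical.epsilon (IsUnitaryGroup ħ H)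

/-- `Ω = s-lim e^{i t H / ħ} e^{-i t H₀ / ħ}` along the filter `l` (`atTop` for `t → +∞`,
`atBot` for `t → -∞`). -/
def IsWaveOperator (ħ : ℝ) (H H₀ : E →ₗ.[ℂ] E) (l : Filter ℝ) (Ω : E →L[ℂ] E) : Prop :=
  ∀ ψ, Tendsto (fun t => unitaryGroup ħ H (-t) (unitaryGroup ħ H₀ t ψ)) l (𝓝 (Ω ψ))

/-- `S = (Ω⁺)* Ω⁻`, where the wave operators `Ω⁺` and `Ω⁻` exist. -/
def IsScatteringOperator (ħ : ℝ) (H H₀ : E →ₗ.[ℂ] E) (S : E →L[ℂ] E) : Prop :=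
  ∃ Ωp Ωm : E →L[ℂ] E, IsWaveOperator ħ H H₀ atTop Ωp ∧ IsWaveOperator ħ H H₀ atBot Ωm ∧
    S = Ωp.adjoint ∘L Ωm

end Scattering

/-! ### The sine and cosine transforms -/

/-- `F` is the unitary operator on `L²(ℝ₊)` given on `L¹ ∩ L²` by
`(F ψ)(k) = -(2i/√(2π)) ∫₀^∞ sin(kx) ψ(x) dx`. -/
def IsSineTransform (F : L2Half →L[ℂ] L2Half) : Prop :=
  F ∈ unitary (L2Half →L[ℂ] L2Half) ∧
    ∀ ψ : L2Half, Integrable ψ halfLine →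
      F ψ =ᵐ[halfLine] fun k : ℝ =>
        -(2 * Complex.I / (Real.sqrt (2 * Real.pi) : ℂ)) *
          ∫ x, (Real.sin (k * x) : ℂ) * ψ x ∂halfLine

/-- `F` is the unitary operator on `L²(ℝ₊)` given on `L¹ ∩ L²` by
`(F ψ)(k) = (2/√(2π)) ∫₀^∞ cos(kx) ψ(x) dx`. -/
def IsCosineTransform (F : L2Half →L[ℂ] L2Half) : Prop :=
  F ∈ unitary (L2Half →L[ℂ] L2Half) ∧
    ∀ ψ : L2Half, Integrable ψ halfLine →
      F ψ =ᵐ[halfLine] fun k : ℝ =>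
        (2 / (Real.sqrt (2 * Real.pi) : ℂ)) *
          ∫ x, (Real.cos (k * x) : ℂ) * ψ x ∂halfLine

/-- The Fourier-sine transform `F_s`, the operator characterized by `IsSineTransform`. -/
def sineTransform : L2Half →L[ℂ] L2Half := Classical.epsilon IsSineTransform

/-- The Fourier-cosine transform `F_c`, the operator characterized by `IsCosineTransform`. -/
def cosineTransform : L2Half →L[ℂ] L2Half := Classical.epsilon IsCosineTransform

/-- The operator `F_c* F_s` on `L²(ℝ₊)`. -/
def cosAdjSin : L2Half →L[ℂ] L2Half := cosineTransform.adjoint ∘L sineTransform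

/-! ### Operators on the graph -/

/-- The direct sum `⊕_{ℓ=1}^n T` of `n` copies of an operator `T` on `L²(ℝ₊)`. -/
def directSum (n : ℕ) (T : L2Half →L[ℂ] L2Half) : L2Graph n →L[ℂ] L2Graph n :=
  ((coords n).symm : (Fin n → L2Half) →L[ℂ] L2Graph n) ∘L
    (ContinuousLinearMap.pi fun ℓ => T ∘L ContinuousLinearMap.proj ℓ) ∘L
    (coords n : L2Graph n →L[ℂ] (Fin n → L2Half))

theorem directSum_apply (n : ℕ) (T : L2Half →L[ℂ] L2Half) (ψ : L2Graph n) (ℓ : Fin n) :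
    directSum n T ψ ℓ = T (ψ ℓ) := rfl

/-- The matrix `𝕊 = 1 - (2/n) J`, with `J` the all-ones matrix. -/
def vertexMatrix (n : ℕ) : Matrix (Fin n) (Fin n) ℂ :=
  1 - (2 / (n : ℂ)) • Matrix.of fun _ _ => 1

theorem vertexMatrix_apply (n : ℕ) (ℓ ℓ' : Fin n) :
    vertexMatrix n ℓ ℓ' = (if ℓ = ℓ' then 1 else 0) - 2 / (n : ℂ) := by
  simp [vertexMatrix, Matrix.one_apply]

/-- The operator on `L²(𝒢)` given by the matrix `𝕊`. -/
def vertexOperator (n : ℕ) : L2Graph n →L[ℂ] L2Graph n :=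
  ((coords n).symm : (Fin n → L2Half) →L[ℂ] L2Graph n) ∘L
    (ContinuousLinearMap.pi fun ℓ =>
      ∑ ℓ', vertexMatrix n ℓ ℓ' • ContinuousLinearMap.proj ℓ') ∘L
    (coords n : L2Graph n →L[ℂ] (Fin n → L2Half))

theorem vertexOperator_apply (n : ℕ) (ψ : L2Graph n) (ℓ : Fin n) :
    vertexOperator n ψ ℓ = ∑ ℓ', vertexMatrix n ℓ ℓ' • ψ ℓ' := by
  simp [vertexOperator]

end StarGraph

end

open StarGraph

/-!
The cosine and the sine transform, `C` and `S`, are unitary involutions of `L²(ℝ₊)` that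
diagonalize `-d²/dx²` with Neumann and with Dirichlet condition at `0` respectively. On the graph,
the projections `(1 - 𝕊)/2 = J/n` and `(1 + 𝕊)/2` reduce both Hamiltonians: `H_D` is the Dirichlet
operator on both parts, whereas `H_K` is the Neumann operator on the symmetric part and the
Dirichlet operator on the antisymmetric one. So the groups are explicit conjugates of the
multiplication groups `e^{-ictk²}`, `c = ħ/2m`, and all that is left of the wave operators is the
limit of `C e^{ictk²} C S e^{-ictk²} S` on the half-line. It is `±F_c* F_s = ∓i C S`, because
`(C ∓ i S) e^{-ictk²} φ` tends to zero as `t → ±∞`: it is the restriction to the half-line of a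
free wave that travels out of it.

* Unitarity: for test functions `C` and `S` are Fourier transforms of even and odd extensions, so
  Plancherel's theorem makes them isometries (`isPlancherelKernel_of_exp`), and they extend by
  density to self-adjoint involutions (`IsPlancherelKernel.op`).
* Domains: `dirichlet_iff` and `neumann_iff` identify the weakly defined second derivatives with
  multiplication by `-k²` on its maximal domain. One direction is duality with test functions; the
  other one needs an integration by parts with a boundary term
  (`IsWeakDeriv.integral_deriv_smul`).
* Generators: a subsequence of the difference quotients converges almost everywhere, so the
  generator of the multiplication group has the maximal domain (`hasDerivAtZero_phaseOp_iff`). A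
  unitary group is determined by its generator (`IsUnitaryGroup.unique`).
* Dispersion: the phase `kx + ctk²` has no stationary point with `x, k, t > 0`, and integrating by
  parts once gives decay (`exists_norm_integral_osc_le`, `tendsto_planeWaveOp_phaseOp`).
* Assembly: `blockOp n A B` acts as `A` on the symmetric and as `B` on the antisymmetric part, and
  turns the computation of the groups, of `Ω^±` and of `(Ω⁺)* Ω⁻` into one with pairs.
-/

namespace StarGraph

/-! ### Test functions on the half-line -/

/-- The complex test functions `C_c^∞((0, ∞))`, as functions on `ℝ`. -/
def testFun : Submodule ℂ (ℝ → ℂ) where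
  carrier := {f | ContDiff ℝ ∞ f ∧ HasCompactSupport f ∧ tsupport f ⊆ Ioi (0 : ℝ)}
  zero_mem' := ⟨contDiff_const, HasCompactSupport.zero, by simp⟩
  add_mem' := by
    rintro f g ⟨h1, h2, h3⟩ ⟨k1, k2, k3⟩
    exact ⟨h1.add k1, h2.add k2, (tsupport_add f g).trans (union_subset h3 k3)⟩
  smul_mem' := by
    rintro c f ⟨h1, h2, h3⟩
    refine ⟨h1.const_smul c, h2.smul_left (f := fun _ => c), ?_⟩
    exact (tsupport_smul_subset_right (fun _ => c) f).trans h3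

/-- The real test functions `C_c^∞((0, ∞))` of `IsWeakDeriv`. -/
def IsRealTest (φ : ℝ → ℝ) : Prop :=
  ContDiff ℝ ∞ φ ∧ HasCompactSupport φ ∧ tsupport φ ⊆ Ioi (0 : ℝ)

theorem IsRealTest.ofReal_mem {φ : ℝ → ℝ} (h : IsRealTest φ) :
    (fun x => (φ x : ℂ)) ∈ testFun := by
  refine ⟨Complex.ofRealCLM.contDiff.comp h.1, h.2.1.comp_left (g := ((↑) : ℝ → ℂ)) (by simp), ?_⟩
  exact (tsupport_comp_subset (g := ((↑) : ℝ → ℂ)) (by simp) φ).trans h.2.2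

theorem IsRealTest.deriv {φ : ℝ → ℝ} (h : IsRealTest φ) : IsRealTest (deriv φ) := by
  refine ⟨(contDiff_infty_iff_deriv.1 h.1).2, h.2.1.deriv, ?_⟩
  exact (tsupport_deriv_subset).trans h.2.2

theorem eq_zero_of_tsupport_subset {E : Type*} [Zero E] {f : ℝ → E}
    (h : tsupport f ⊆ Ioi (0 : ℝ)) {x : ℝ} (hx : x ≤ 0) : f x = 0 := by
  by_contra hne
  exact absurd (h (subset_tsupport _ hne)) (not_lt.2 hx)

theorem setIntegral_Ioi_eq_integral {E : Type*} [NormedAddCommGroup E] [NormedSpace ℝ E]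
    {f : ℝ → E} (h : ∀ x ≤ 0, f x = 0) : ∫ x, f x ∂halfLine = ∫ x, f x :=
  setIntegral_eq_integral_of_forall_compl_eq_zero fun x hx => h x (not_lt.1 hx)

namespace testFun

variable (f : testFun)

theorem contDiff : ContDiff ℝ ∞ (f : ℝ → ℂ) := f.2.1

theorem continuous : Continuous (f : ℝ → ℂ) := f.2.1.continuous

theorem hasCompactSupport : HasCompactSupport (f : ℝ → ℂ) := f.2.2.1

theorem eq_zero {x : ℝ} (hx : x ≤ 0) : (f : ℝ → ℂ) x = 0 :=
  eq_zero_of_tsupport_subset f.2.2.2 hx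

theorem integrable : Integrable (f : ℝ → ℂ) :=
  (continuous f).integrable_of_hasCompactSupport (hasCompactSupport f)

theorem memLp : MemLp (f : ℝ → ℂ) 2 halfLine :=
  ((continuous f).memLp_of_hasCompactSupport (hasCompactSupport f)).restrict _

/-- The support lies in some `[a, b]` with `0 < a`. -/
theorem exists_support : ∃ a b : ℝ, 0 < a ∧ a < b ∧ ∀ x, x ∉ Ioo a b → (f : ℝ → ℂ) x = 0 := by
  have hK : IsCompact (tsupport (f : ℝ → ℂ)) := hasCompactSupport f
  by_cases hne : (tsupport (f : ℝ → ℂ)).Nonempty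
  · obtain ⟨a, ha, ha'⟩ := hK.exists_isLeast hne
    obtain ⟨b, hb, hb'⟩ := hK.exists_isGreatest hne
    have h0 : 0 < a := f.2.2.2 ha
    have hab : a ≤ b := ha' hb
    refine ⟨a / 2, b + 1, by linarith, by linarith, fun x hx => ?_⟩
    by_contra h
    have hx' := subset_tsupport _ (Function.mem_support.2 h)
    exact hx ⟨by linarith [ha' hx'], by linarith [hb' hx']⟩
  · refine ⟨1, 2, by norm_num, by norm_num, fun x _ => ?_⟩
    by_contra h
    exact hne ⟨x, subset_tsupport _ (Function.mem_support.2 h)⟩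

end testFun

/-- The class of a test function in `L²(ℝ₊)`. -/
noncomputable def testToL2 : testFun →ₗ[ℂ] L2Half where
  toFun f := (testFun.memLp f).toLp _
  map_add' _ _ := rfl
  map_smul' _ _ := rfl

theorem testToL2_coe (f : testFun) : testToL2 f =ᵐ[halfLine] (f : ℝ → ℂ) :=
  (testFun.memLp f).coeFn_toLp

/-- Two locally integrable functions with the same integrals against all real test functions
agree almost everywhere. -/
theorem ae_eq_of_integral_test {f g : ℝ → ℂ} (hf : LocallyIntegrable f halfLine)
    (hg : LocallyIntegrable g halfLine)
    (h : ∀ φ : ℝ → ℝ, IsRealTest φ →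
      ∫ x, φ x • f x ∂halfLine = ∫ x, φ x • g x ∂halfLine) : f =ᵐ[halfLine] g := by
  have key : ∀ᵐ x ∂(volume : Measure ℝ), x ∈ Ioi (0 : ℝ) → (f - g) x = 0 := by
    apply isOpen_Ioi.ae_eq_zero_of_integral_contDiff_smul_eq_zero
    · exact locallyIntegrableOn_of_locallyIntegrable_restrict (hf.sub hg)
    · intro φ h1 h2 h3
      have hz : ∀ x ≤ 0, φ x • (f - g) x = 0 := fun x hx => by
        rw [eq_zero_of_tsupport_subset h3 hx, zero_smul]
      rw [← setIntegral_Ioi_eq_integral hz]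
      have e : ∀ x, φ x • (f - g) x = φ x • f x - φ x • g x := fun x => smul_sub _ _ _
      simp_rw [e]
      rw [integral_sub (hf.integrable_smul_left_of_hasCompactSupport h1.continuous h2)
        (hg.integrable_smul_left_of_hasCompactSupport h1.continuous h2), h φ ⟨h1, h2, h3⟩, sub_self]
  have h' : ∀ᵐ x ∂halfLine, (f - g) x = 0 := (ae_restrict_iff' measurableSet_Ioi).2 key
  filter_upwards [h'] with x hx
  exact sub_eq_zero.1 hx

theorem locallyIntegrable_L2 (f : L2Half) : LocallyIntegrable f halfLine :=
  (Lp.memLp f).locallyIntegrable (by norm_num)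

/-- The inner product with a real function is the integral of the product. -/
theorem inner_of_ae_real {g : L2Half} {φ : ℝ → ℝ} (hg : g =ᵐ[halfLine] fun x => (φ x : ℂ))
    (f : L2Half) : inner ℂ g f = ∫ x, φ x • f x ∂halfLine := by
  rw [L2.inner_def]
  apply integral_congr_ae
  filter_upwards [hg] with x hx
  simp [hx, mul_comm]

theorem denseRange_testToL2 : DenseRange testToL2 := by
  have : (LinearMap.range testToL2).topologicalClosure = ⊤ := by
    rw [Submodule.topologicalClosure_eq_top_iff, Submodule.eq_bot_iff]
    intro f hf
    rw [Submodule.mem_orthogonal] at hf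
    apply Lp.ext
    refine (ae_eq_of_integral_test (locallyIntegrable_L2 f) (locallyIntegrable_L2 0)
      fun φ hφ => ?_)
    have h0 := hf _ (LinearMap.mem_range_self testToL2 ⟨_, hφ.ofReal_mem⟩)
    have e := testToL2_coe ⟨_, hφ.ofReal_mem⟩
    rw [← inner_of_ae_real e, ← inner_of_ae_real e, h0, inner_zero_right]
  have h2 := Submodule.dense_iff_topologicalClosure_eq_top.2 this
  rwa [DenseRange, ← LinearMap.coe_range]

/-! ### Trigonometric integrals -/

/-- The integral transform `k ↦ (2/√(2π)) ∫₀^∞ κ(kx) f(x) dx`; the kernels of interest are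
`κ = cos` and `κ = sin`. -/
noncomputable def trigInt (κ : ℝ → ℝ) (f : ℝ → ℂ) (k : ℝ) : ℂ :=
  (2 / (Real.sqrt (2 * Real.pi) : ℂ)) * ∫ x, (κ (k * x) : ℂ) * f x ∂halfLine

theorem norm_sq_trigInt (κ : ℝ → ℝ) (f : ℝ → ℂ) (k : ℝ) :
    ‖trigInt κ f k‖ ^ 2 = (2 / Real.pi) * ‖∫ x, (κ (k * x) : ℂ) * f x ∂halfLine‖ ^ 2 := by
  have hpi := Real.pi_pos
  rw [trigInt, norm_mul, mul_pow, norm_div, div_pow, Complex.norm_real, Real.norm_eq_abs, sq_abs,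
    Real.sq_sqrt (by positivity)]
  congr 1
  simp
  field_simp

open FourierTransform in
/-- The Fourier transform of the even (`σ = 1`, `κ = cos`) or odd (`σ = -1`, `κ = sin`)
extension of a test function. -/
theorem exists_schwartz_extension {κ : ℝ → ℝ} {u σ : ℂ}
    (hκ : ∀ y : ℝ, Complex.exp (-(Complex.I * y)) + σ * Complex.exp (Complex.I * y)
      = 2 * u * κ y) (f : testFun) :
    ∃ h : SchwartzMap ℝ ℂ, (∀ x, h x = (f : ℝ → ℂ) x + σ * (f : ℝ → ℂ) (-x)) ∧
      ∀ ξ, 𝓕 h ξ = 2 * u * ∫ x, (κ ((2 * Real.pi * ξ) * x) : ℂ) * (f : ℝ → ℂ) x ∂halfLine := by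
  have hn : ContDiff ℝ ∞ fun x => (f : ℝ → ℂ) (-x) := (testFun.contDiff f).comp contDiff_neg
  have hcn : HasCompactSupport fun x => (f : ℝ → ℂ) (-x) :=
    (testFun.hasCompactSupport f).comp_homeomorph (Homeomorph.neg ℝ)
  have h1 : ContDiff ℝ ∞ fun x => (f : ℝ → ℂ) x + σ * (f : ℝ → ℂ) (-x) :=
    (testFun.contDiff f).add (contDiff_const.mul hn)
  have h2 : HasCompactSupport fun x => (f : ℝ → ℂ) x + σ * (f : ℝ → ℂ) (-x) :=
    (testFun.hasCompactSupport f).add (hcn.mul_left (f := fun _ => σ))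
  refine ⟨h2.toSchwartzMap h1, fun x => rfl, fun ξ => ?_⟩
  rw [SchwartzMap.fourier_coe, Real.fourier_eq']
  have hfi : Integrable (f : ℝ → ℂ) := testFun.integrable f
  have hfn : Integrable fun x => (f : ℝ → ℂ) (-x) := hfi.comp_neg
  have bd : ∀ (g : ℝ → ℂ) (s : ℝ), Integrable g →
      Integrable fun x : ℝ => Complex.exp (Complex.I * ((s * x : ℝ) : ℂ)) * g x := by
    intro g s hg
    refine hg.bdd_mul (c := 1) (by fun_prop) (Eventually.of_forall fun x => ?_)
    rw [mul_comm, Complex.norm_exp_ofReal_mul_I]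
  have e1 : ∀ x : ℝ, Complex.exp (↑(-2 * Real.pi * inner ℝ x ξ) * Complex.I) •
      (h2.toSchwartzMap h1) x
      = Complex.exp (Complex.I * (((-2 * Real.pi * ξ) * x : ℝ) : ℂ)) * (f : ℝ → ℂ) x
        + σ * (Complex.exp (Complex.I * (((-2 * Real.pi * ξ) * x : ℝ) : ℂ)) *
          (f : ℝ → ℂ) (-x)) := by
    intro x
    change _ • ((f : ℝ → ℂ) x + σ * (f : ℝ → ℂ) (-x)) = _
    have : (↑(-2 * Real.pi * inner ℝ x ξ) * Complex.I)
      = Complex.I * (((-2 * Real.pi * ξ) * x : ℝ) : ℂ) := by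
      simp
      ring
    rw [this, smul_eq_mul]
    ring
  simp_rw [e1]
  rw [integral_add (bd _ _ hfi) ((bd _ _ hfn).const_mul σ), integral_const_mul]
  have e2 : ∫ x : ℝ, Complex.exp (Complex.I * (((-2 * Real.pi * ξ) * x : ℝ) : ℂ)) *
          (f : ℝ → ℂ) (-x) = ∫ x : ℝ, Complex.exp (Complex.I * (((2 * Real.pi * ξ) * x : ℝ) : ℂ)) *
          (f : ℝ → ℂ) x := by
    rw [← integral_neg_eq_self]
    congr 1
    ext x
    rw [neg_neg]
    congr 4
    ring
  rw [e2, ← integral_const_mul σ, ← integral_add (bd _ _ hfi) ((bd _ _ hfi).const_mul σ),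
    ← integral_const_mul, setIntegral_Ioi_eq_integral]
  · congr 1
    ext x
    have := hκ ((2 * Real.pi * ξ) * x)
    rw [← mul_assoc (2 * u), ← this]
    push_cast
    ring_nf
  · intro x hx
    rw [testFun.eq_zero f hx, mul_zero, mul_zero]

/-- A bounded continuous kernel `κ` whose transform `trigInt κ` satisfies the Plancherel identity
on test functions, hence extends to a unitary operator. -/
structure IsPlancherelKernel (κ : ℝ → ℝ) : Prop where
  continuous : Continuous κ
  bound : ∀ y, |κ y| ≤ 1
  memLp : ∀ f : testFun, MemLp (trigInt κ f) 2 halfLine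
  integral_eq : ∀ f : testFun,
    ∫ k, ‖trigInt κ f k‖ ^ 2 ∂halfLine = ∫ x, ‖(f : ℝ → ℂ) x‖ ^ 2 ∂halfLine

open FourierTransform in
theorem isPlancherelKernel_of_exp {κ : ℝ → ℝ} {u σ : ℂ} (hu : ‖u‖ = 1) (hσ : ‖σ‖ = 1)
    (hc : Continuous κ) (hb : ∀ y, |κ y| ≤ 1)
    (hs : (∀ y, κ (-y) = κ y) ∨ ∀ y, κ (-y) = -κ y)
    (hκ : ∀ y : ℝ, Complex.exp (-(Complex.I * y)) + σ * Complex.exp (Complex.I * y)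
      = 2 * u * κ y) : IsPlancherelKernel κ := by
  have hpi := Real.pi_pos
  have hu0 : u ≠ 0 := by
    rintro rfl
    simp at hu
  have key : ∀ f : testFun, MemLp (trigInt κ f) 2 halfLine ∧
      ∫ k, ‖trigInt κ f k‖ ^ 2 ∂halfLine = ∫ x, ‖(f : ℝ → ℂ) x‖ ^ 2 ∂halfLine := by
    intro f
    obtain ⟨h, h1, h2⟩ := exists_schwartz_extension hκ f
    set A : ℝ → ℂ := fun k => ∫ x, (κ (k * x) : ℂ) * (f : ℝ → ℂ) x ∂halfLine with hA
    have hAF : ∀ k, A k = (2 * u)⁻¹ * 𝓕 h (k / (2 * Real.pi)) := by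
      intro k
      have e : (2 * Real.pi * (k / (2 * Real.pi))) = k := by field_simp
      have := h2 (k / (2 * Real.pi))
      rw [e] at this
      rw [this]
      field_simp
      rfl
    have hcont : Continuous A := by
      have : A = fun k => (2 * u)⁻¹ * 𝓕 h (k / (2 * Real.pi)) := funext hAF
      rw [this]
      exact continuous_const.mul ((𝓕 h).continuous.comp (by fun_prop))
    have hnorm : ∀ ξ, ‖𝓕 h ξ‖ ^ 2 = 4 * ‖A (2 * Real.pi * ξ)‖ ^ 2 := by
      intro ξ
      rw [h2, norm_mul, norm_mul, hu, mul_pow]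
      norm_num [hA]
    have hint : Integrable fun k => ‖A k‖ ^ 2 := by
      have h0 : Integrable fun ξ => ‖𝓕 h ξ‖ ^ 2 :=
        (memLp_two_iff_integrable_sq_norm (𝓕 h).continuous.aestronglyMeasurable).1
          ((𝓕 h).memLp 2 volume)
      have h3 := (h0.comp_div (R := 2 * Real.pi) (by positivity)).const_mul (1 / 4)
      refine h3.congr (Eventually.of_forall fun k => ?_)
      simp only
      rw [hnorm]
      have e : (2 * Real.pi * (k / (2 * Real.pi))) = k := by field_simp
      rw [e]
      ring
    have heven : ∀ k, ‖A k‖ ^ 2 = ‖A |k|‖ ^ 2 := by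
      intro k
      rcases abs_choice k with hk | hk
      · rw [hk]
      · rw [hk]
        have : A (-k) = A k ∨ A (-k) = -A k := by
          rcases hs with hs | hs
          · left
            simp only [hA, neg_mul, hs]
          · right
            simp only [hA, neg_mul, hs, Complex.ofReal_neg, integral_neg]
        rcases this with h | h
        · rw [h]
        · rw [h, norm_neg]
    have hpl := SchwartzMap.integral_norm_sq_fourier h
    constructor
    · exact ((memLp_two_iff_integrable_sq_norm hcont.aestronglyMeasurable).2 hint).restrict _
        |>.const_mul _
    · simp_rw [norm_sq_trigInt]
      rw [integral_const_mul]
      simp_rw [hnorm] at hpl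
      rw [integral_const_mul, Measure.integral_comp_mul_left (fun k => ‖A k‖ ^ 2)] at hpl
      rw [integral_congr_ae (Eventually.of_forall heven),
        integral_comp_abs (f := fun k => ‖A k‖ ^ 2)] at hpl
      have hr : ∀ x, ‖h x‖ ^ 2 = ‖(f : ℝ → ℂ) |x|‖ ^ 2 := by
        intro x
        rw [h1]
        rcases le_total x 0 with hx | hx
        · rw [testFun.eq_zero f hx, zero_add, norm_mul, hσ, one_mul, abs_of_nonpos hx]
        · rw [testFun.eq_zero f (x := -x) (by linarith), mul_zero, add_zero, abs_of_nonneg hx]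
      rw [integral_congr_ae (Eventually.of_forall hr),
        integral_comp_abs (f := fun k => ‖(f : ℝ → ℂ) k‖ ^ 2)] at hpl
      rw [abs_of_pos (by positivity), smul_eq_mul] at hpl
      simp only [hA] at hpl
      field_simp at hpl ⊢
      linarith
  exact ⟨hc, hb, fun f => (key f).1, fun f => (key f).2⟩

/-! ### The unitary extension of the transforms -/

theorem isPlancherelKernel_cos : IsPlancherelKernel Real.cos := by
  refine isPlancherelKernel_of_exp (u := 1) (σ := 1) (by simp) (by simp) Real.continuous_cos
    Real.abs_cos_le_one (Or.inl Real.cos_neg) fun y => ?_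
  rw [Complex.ofReal_cos, Complex.cos]
  ring_nf

theorem isPlancherelKernel_sin : IsPlancherelKernel Real.sin := by
  refine isPlancherelKernel_of_exp (u := -Complex.I) (σ := -1) (by simp) (by simp)
    Real.continuous_sin Real.abs_sin_le_one (Or.inr Real.sin_neg) fun y => ?_
  rw [Complex.ofReal_sin, Complex.sin]
  ring_nf
  simp
  ring_nf

namespace IsPlancherelKernel

variable {κ : ℝ → ℝ} (hκ : IsPlancherelKernel κ)
include hκ

theorem integrable_mul {f : ℝ → ℂ} (hf : Integrable f halfLine) (k : ℝ) :
    Integrable (fun x => (κ (k * x) : ℂ) * f x) halfLine := by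
  have := hκ.continuous
  refine hf.bdd_mul (c := 1) (by fun_prop) (Eventually.of_forall fun x => ?_)
  simpa using hκ.bound (k * x)

theorem continuous_trigInt {f : ℝ → ℂ} (hf : Integrable f halfLine) :
    Continuous (trigInt κ f) := by
  have := hκ.continuous
  refine continuous_const.mul ?_
  refine continuous_of_dominated (bound := fun x => ‖f x‖)
    (fun k => (hκ.integrable_mul hf k).aestronglyMeasurable)
    (fun k => Eventually.of_forall fun x => ?_) hf.norm
    (Eventually.of_forall fun x => by fun_prop)
  rw [norm_mul, Complex.norm_real]
  exact mul_le_of_le_one_left (norm_nonneg _) (hκ.bound _)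

/-- The transform is symmetric for the bilinear pairing, by Fubini's theorem. -/
theorem integral_trigInt_mul {f g : ℝ → ℂ} (hf : Integrable f halfLine)
    (hg : Integrable g halfLine) :
    ∫ k, trigInt κ f k * g k ∂halfLine = ∫ x, f x * trigInt κ g x ∂halfLine := by
  have := hκ.continuous
  have hF : Integrable (fun p : ℝ × ℝ => (κ (p.1 * p.2) : ℂ) * (g p.1 * f p.2))
      (halfLine.prod halfLine) := by
    refine (hg.mul_prod hf).bdd_mul (c := 1) (by fun_prop) (Eventually.of_forall fun x => ?_)
    simpa using hκ.bound _
  have hsw := integral_integral_swap (f := fun k x => (κ (k * x) : ℂ) * (g k * f x)) hF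
  have e1 : ∀ k, trigInt κ f k * g k = (2 / (Real.sqrt (2 * Real.pi) : ℂ)) *
      ∫ x, (κ (k * x) : ℂ) * (g k * f x) ∂halfLine := by
    intro k
    rw [trigInt, mul_assoc, ← integral_mul_const]
    congr 2
    ext x
    ring
  have e2 : ∀ x, f x * trigInt κ g x = (2 / (Real.sqrt (2 * Real.pi) : ℂ)) *
      ∫ k, (κ (k * x) : ℂ) * (g k * f x) ∂halfLine := by
    intro x
    rw [trigInt, mul_comm, mul_assoc, ← integral_mul_const]
    congr 2
    ext k
    rw [mul_comm x k]
    ring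
  simp_rw [e1, e2]
  rw [integral_const_mul, integral_const_mul, hsw]

omit hκ in
theorem conj_trigInt (f : ℝ → ℂ) (k : ℝ) :
    (starRingEnd ℂ) (trigInt κ f k) = trigInt κ (fun x => (starRingEnd ℂ) (f x)) k := by
  rw [trigInt, trigInt, map_mul, ← integral_conj]
  simp only [map_mul, map_div₀, Complex.conj_ofReal, map_ofNat]

/-- The transform on test functions, as a linear map into `L²(ℝ₊)`. -/
noncomputable def testMap : testFun →ₗ[ℂ] L2Half where
  toFun f := (hκ.memLp f).toLp _
  map_add' f g := by
    rw [← MemLp.toLp_add]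
    congr 1
    ext k
    simp only [trigInt, Submodule.coe_add, Pi.add_apply, mul_add]
    rw [integral_add (hκ.integrable_mul (testFun.integrable f).integrableOn k)
      (hκ.integrable_mul (testFun.integrable g).integrableOn k), mul_add]
  map_smul' c f := by
    rw [RingHom.id_apply, ← MemLp.toLp_const_smul]
    congr 1
    ext k
    simp only [trigInt, Submodule.coe_smul, Pi.smul_apply, smul_eq_mul]
    rw [mul_left_comm, ← integral_const_mul c]
    congr 2
    ext x
    ring

theorem norm_testMap (f : testFun) : ‖hκ.testMap f‖ = ‖testToL2 f‖ := by
  have h : ∀ g : ℝ → ℂ, ∀ hg : MemLp g 2 halfLine,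
      ‖hg.toLp g‖ ^ 2 = ∫ x, ‖g x‖ ^ 2 ∂halfLine := by
    intro g hg
    have h1 : inner ℂ (hg.toLp g) (hg.toLp g) = ((∫ x, ‖g x‖ ^ 2 ∂halfLine : ℝ) : ℂ) := by
      rw [L2.inner_def]
      refine Eq.trans ?_ integral_ofReal
      apply integral_congr_ae
      filter_upwards [hg.coeFn_toLp] with x hx
      rw [hx, inner_self_eq_norm_sq_to_K]
      simp
    rw [inner_self_eq_norm_sq_to_K] at h1
    exact Complex.ofReal_injective (by rw [← h1]; simp)
  have h2 : ‖hκ.testMap f‖ ^ 2 = ‖testToL2 f‖ ^ 2 :=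
    (h _ (hκ.memLp f)).trans ((hκ.integral_eq f).trans (h _ (testFun.memLp f)).symm)
  exact (pow_left_inj₀ (norm_nonneg _) (norm_nonneg _) two_ne_zero).1 h2

/-- The extension of the transform from test functions to `L²(ℝ₊)`. -/
noncomputable def op : L2Half →L[ℂ] L2Half := hκ.testMap.extendOfNorm testToL2

theorem op_testToL2 (f : testFun) : hκ.op (testToL2 f) = hκ.testMap f :=
  LinearMap.extendOfNorm_eq denseRange_testToL2
    ⟨1, fun x => by rw [one_mul, hκ.norm_testMap]⟩ f

theorem op_testToL2_coe (f : testFun) : hκ.op (testToL2 f) =ᵐ[halfLine] trigInt κ f := by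
  rw [hκ.op_testToL2]
  exact (hκ.memLp f).coeFn_toLp

theorem norm_op (ψ : L2Half) : ‖hκ.op ψ‖ = ‖ψ‖ := by
  refine denseRange_testToL2.induction_on ψ
    (isClosed_eq hκ.op.continuous.norm continuous_norm) fun f => ?_
  rw [hκ.op_testToL2, hκ.norm_testMap]

theorem inner_op_op (ψ η : L2Half) : inner ℂ (hκ.op ψ) (hκ.op η) = inner ℂ ψ η :=
  (LinearMap.norm_map_iff_inner_map_map hκ.op).1 hκ.norm_op ψ η

theorem inner_op_left (ψ η : L2Half) : inner ℂ (hκ.op ψ) η = inner ℂ ψ (hκ.op η) := by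
  have hc := hκ.op.continuous
  refine denseRange_testToL2.induction_on ψ
    (isClosed_eq (by fun_prop) (by fun_prop)) fun f => ?_
  refine denseRange_testToL2.induction_on η
    (isClosed_eq (by fun_prop) (by fun_prop)) fun g => ?_
  have hf : Integrable (f : ℝ → ℂ) halfLine := (testFun.integrable f).integrableOn
  have hg : Integrable (g : ℝ → ℂ) halfLine := (testFun.integrable g).integrableOn
  have hf' : Integrable (fun x => (starRingEnd ℂ) ((f : ℝ → ℂ) x)) halfLine :=
    (Complex.conjCLE : ℂ →L[ℝ] ℂ).integrable_comp hf
  have h := hκ.integral_trigInt_mul hf' hg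
  rw [L2.inner_def, L2.inner_def]
  calc _ = ∫ k, trigInt κ (fun x => (starRingEnd ℂ) ((f : ℝ → ℂ) x)) k * (g : ℝ → ℂ) k
            ∂halfLine := by
        apply integral_congr_ae
        filter_upwards [hκ.op_testToL2_coe f, testToL2_coe g] with k h1 h2
        rw [h1, h2, RCLike.inner_apply, conj_trigInt, mul_comm]
    _ = _ := h
    _ = _ := by
        apply integral_congr_ae
        filter_upwards [hκ.op_testToL2_coe g, testToL2_coe f] with k h1 h2
        rw [h1, h2, RCLike.inner_apply, mul_comm]

theorem op_op (ψ : L2Half) : hκ.op (hκ.op ψ) = ψ := by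
  apply ext_inner_right ℂ
  intro η
  rw [hκ.inner_op_left, hκ.inner_op_op]

theorem op_comp_op : hκ.op * hκ.op = 1 := by
  ext1 ψ
  exact hκ.op_op ψ

theorem star_op : star hκ.op = hκ.op := by
  rw [ContinuousLinearMap.star_eq_adjoint]
  symm
  rw [ContinuousLinearMap.eq_adjoint_iff]
  exact hκ.inner_op_left

/-- Testing `hκ.op ψ` against a real test function. -/
theorem integral_test_op {φ : ℝ → ℝ} (hφ : IsRealTest φ) (ψ : L2Half) :
    ∫ x, φ x • (hκ.op ψ) x ∂halfLine
      = inner ℂ (hκ.op (testToL2 ⟨_, hφ.ofReal_mem⟩)) ψ := by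
  rw [hκ.inner_op_left, inner_of_ae_real (testToL2_coe ⟨_, hφ.ofReal_mem⟩)]

/-- On `L¹ ∩ L²` the extended transform is still given by the integral. -/
theorem op_coe_of_integrable {ψ : L2Half} (hψ : Integrable ψ halfLine) :
    hκ.op ψ =ᵐ[halfLine] trigInt κ ψ := by
  refine ae_eq_of_integral_test (locallyIntegrable_L2 _)
    (hκ.continuous_trigInt hψ).locallyIntegrable fun φ hφ => ?_
  have hi : Integrable (fun x => (φ x : ℂ)) halfLine :=
    (testFun.integrable ⟨_, hφ.ofReal_mem⟩).integrableOn
  rw [hκ.integral_test_op hφ, L2.inner_def]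
  calc _ = ∫ x, trigInt κ (fun x => (φ x : ℂ)) x * ψ x ∂halfLine := by
        apply integral_congr_ae
        filter_upwards [hκ.op_testToL2_coe ⟨_, hφ.ofReal_mem⟩] with x hx
        rw [hx, RCLike.inner_apply, conj_trigInt, mul_comm]
        simp
    _ = _ := hκ.integral_trigInt_mul hi hψ
    _ = _ := by simp

/-- A bounded operator given by the integral on `L¹ ∩ L²` is the extended transform. -/
theorem eq_op {F : L2Half →L[ℂ] L2Half} {c : ℂ}
    (hF : ∀ ψ : L2Half, Integrable ψ halfLine → F ψ =ᵐ[halfLine] fun k => c * trigInt κ ψ k) :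
    F = c • hκ.op := by
  ext1 ψ
  refine denseRange_testToL2.induction_on ψ
    (isClosed_eq F.continuous (c • hκ.op).continuous) fun f => ?_
  have hi : Integrable (testToL2 f) halfLine :=
    (testFun.integrable f).integrableOn.congr (testToL2_coe f).symm
  apply Lp.ext
  filter_upwards [hF _ hi, hκ.op_coe_of_integrable hi, Lp.coeFn_smul c (hκ.op (testToL2 f))]
    with k h1 h2 h3
  rw [h1, smul_apply, h3, Pi.smul_apply, h2, smul_eq_mul]

theorem smul_op_mem_unitary {c : ℂ} (hc : ‖c‖ = 1) :
    c • hκ.op ∈ unitary (L2Half →L[ℂ] L2Half) := by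
  have h1 : star c * c = 1 := by
    simpa [hc] using Complex.conj_mul' c
  rw [Unitary.mem_iff]
  simp only [star_smul, hκ.star_op, smul_mul_smul_comm, hκ.op_comp_op, h1, mul_comm c, one_smul,
    and_self]

end IsPlancherelKernel

/-! ### The sine and cosine transforms -/

theorem isSineTransform_iff (F : L2Half →L[ℂ] L2Half) :
    IsSineTransform F ↔ F = (-Complex.I) • isPlancherelKernel_sin.op := by
  have e : ∀ (ψ : L2Half) (k : ℝ), -(2 * Complex.I / (Real.sqrt (2 * Real.pi) : ℂ)) *
      ∫ x, (Real.sin (k * x) : ℂ) * ψ x ∂halfLine = -Complex.I * trigInt Real.sin ψ k := by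
    intro ψ k
    rw [trigInt]
    ring
  constructor
  · rintro ⟨-, h⟩
    refine isPlancherelKernel_sin.eq_op fun ψ hψ => ?_
    simpa only [e] using h ψ hψ
  · rintro rfl
    refine ⟨isPlancherelKernel_sin.smul_op_mem_unitary (by simp), fun ψ hψ => ?_⟩
    simp only [e]
    filter_upwards [isPlancherelKernel_sin.op_coe_of_integrable hψ,
      Lp.coeFn_smul (-Complex.I) (isPlancherelKernel_sin.op ψ)] with k h1 h2
    rw [smul_apply, h2, Pi.smul_apply, h1, smul_eq_mul]

theorem isCosineTransform_iff (F : L2Half →L[ℂ] L2Half) :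
    IsCosineTransform F ↔ F = isPlancherelKernel_cos.op := by
  constructor
  · rintro ⟨-, h⟩
    rw [isPlancherelKernel_cos.eq_op (F := F) (c := 1) fun ψ hψ => ?_, one_smul]
    simpa only [one_mul, trigInt] using h ψ hψ
  · rintro rfl
    refine ⟨?_, fun ψ hψ => isPlancherelKernel_cos.op_coe_of_integrable hψ⟩
    simpa using isPlancherelKernel_cos.smul_op_mem_unitary (c := 1) (by simp)

theorem sineTransform_eq : sineTransform = (-Complex.I) • isPlancherelKernel_sin.op :=
  (isSineTransform_iff _).1 (Classical.epsilon_spec ⟨_, (isSineTransform_iff _).2 rfl⟩)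

theorem cosineTransform_eq : cosineTransform = isPlancherelKernel_cos.op :=
  (isCosineTransform_iff _).1 (Classical.epsilon_spec ⟨_, (isCosineTransform_iff _).2 rfl⟩)

/-! ### From decay of the transform to Sobolev regularity -/

theorem IsRealTest.hasDerivAt {φ : ℝ → ℝ} (hφ : IsRealTest φ) (x : ℝ) :
    HasDerivAt φ (_root_.deriv φ x) x :=
  (hφ.1.differentiable (by simp) x).hasDerivAt

/-- Integration by parts: if `κ' = ε ρ`, then the `κ`-transform of `φ'` is `-ε k` times the
`ρ`-transform of `φ`. -/
theorem trigInt_deriv {κ ρ : ℝ → ℝ} (hκ : IsPlancherelKernel κ) (hρ : IsPlancherelKernel ρ) {ε : ℝ}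
    (hd : ∀ y, HasDerivAt κ (ε * ρ y) y) {φ : ℝ → ℝ} (hφ : IsRealTest φ) (k : ℝ) :
    trigInt κ (fun x => ((deriv φ x : ℝ) : ℂ)) k
      = ((-(ε * k) : ℝ) : ℂ) * trigInt ρ (fun x => (φ x : ℂ)) k := by
  have hi := testFun.integrable ⟨_, hφ.ofReal_mem⟩
  have hi' := testFun.integrable ⟨_, hφ.deriv.ofReal_mem⟩
  have bd : ∀ {κ : ℝ → ℝ} (_ : IsPlancherelKernel κ) {g : ℝ → ℂ} (_ : Integrable g),
      Integrable fun x : ℝ => (κ (k * x) : ℂ) * g x := by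
    intro κ hκ g hg
    have := hκ.continuous
    refine hg.bdd_mul (c := 1) (by fun_prop) (Eventually.of_forall fun x => ?_)
    simpa using hκ.bound (k * x)
  have hu : ∀ x : ℝ, HasDerivAt (fun x : ℝ => (κ (k * x) : ℂ)) (ε * k * ρ (k * x) : ℝ) x := by
    intro x
    have h := (hd (k * x)).comp x ((hasDerivAt_id x).const_mul k)
    simp only [mul_one] at h
    rw [show ε * k * ρ (k * x) = ε * ρ (k * x) * k by ring]
    exact h.ofReal_comp
  have hv : ∀ x : ℝ, HasDerivAt (fun x : ℝ => (φ x : ℂ)) ((deriv φ x : ℝ) : ℂ) x :=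
    fun x => (hφ.hasDerivAt x).ofReal_comp
  have h := integral_mul_deriv_eq_deriv_mul_of_integrable (fun x _ => hu x) (fun x _ => hv x)
    (bd hκ hi')
    (by
      refine ((bd hρ hi).const_mul ((ε * k : ℝ) : ℂ)).congr (Eventually.of_forall fun x => ?_)
      simp [mul_assoc])
    (bd hκ hi)
  rw [trigInt, trigInt, setIntegral_Ioi_eq_integral, setIntegral_Ioi_eq_integral, h,
    mul_left_comm, ← integral_const_mul, ← integral_neg]
  · congr 1
    apply integral_congr_ae
    refine Eventually.of_forall fun x => ?_
    simp [mul_assoc]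
  · intro x hx
    simp [eq_zero_of_tsupport_subset hφ.2.2 hx]
  · intro x hx
    simp [eq_zero_of_tsupport_subset hφ.deriv.2.2 hx]

theorem inner_mul_left_of_ae {f g h h₁ : L2Half} {w : ℝ → ℝ}
    (hf : f =ᵐ[halfLine] fun k => (w k : ℂ) * g k)
    (hh : h₁ =ᵐ[halfLine] fun k => (w k : ℂ) * h k) : inner ℂ f h = inner ℂ g h₁ := by
  rw [L2.inner_def, L2.inner_def]
  apply integral_congr_ae
  filter_upwards [hf, hh] with k h1 h2
  rw [h1, h2]
  simp
  ring

/-- If `κ' = ε ρ`, and `φ` and `kφ` are square integrable, then the `κ`-transform of `φ` has weak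
derivative `ε` times the `ρ`-transform of `kφ`. -/
theorem isWeakDeriv_op {κ ρ : ℝ → ℝ} (hκ : IsPlancherelKernel κ) (hρ : IsPlancherelKernel ρ)
    {ε : ℝ} (hd : ∀ y, HasDerivAt κ (ε * ρ y) y) {φ φ₁ : L2Half}
    (h : φ₁ =ᵐ[halfLine] fun k => (k : ℂ) * φ k) :
    IsWeakDeriv (hκ.op φ) ((ε : ℂ) • hρ.op φ₁) := by
  intro χ h1 h2 h3
  have hχ : IsRealTest χ := ⟨h1, h2, h3⟩
  rw [hκ.integral_test_op hχ.deriv, ← map_smul, hρ.integral_test_op hχ, ← inner_neg_right]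
  refine inner_mul_left_of_ae (g := hρ.op (testToL2 ⟨_, hχ.ofReal_mem⟩))
    (w := fun k => -(ε * k)) ?_ ?_
  · filter_upwards [hκ.op_testToL2_coe ⟨_, hχ.deriv.ofReal_mem⟩,
      hρ.op_testToL2_coe ⟨_, hχ.ofReal_mem⟩] with k e1 e2
    rw [e1, e2]
    exact trigInt_deriv hκ hρ hd hχ k
  · filter_upwards [h, Lp.coeFn_neg ((ε : ℂ) • φ₁), Lp.coeFn_smul (ε : ℂ) φ₁] with k e1 e2 e3
    rw [e2, Pi.neg_apply, e3, Pi.smul_apply, e1]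
    simp
    ring

theorem isWeakDeriv_sin {φ φ₁ : L2Half} (h : φ₁ =ᵐ[halfLine] fun k => (k : ℂ) * φ k) :
    IsWeakDeriv (isPlancherelKernel_sin.op φ) (isPlancherelKernel_cos.op φ₁) := by
  simpa using isWeakDeriv_op isPlancherelKernel_sin isPlancherelKernel_cos (ε := 1)
    (fun y => by simpa using Real.hasDerivAt_sin y) h

theorem isWeakDeriv_cos {φ φ₁ : L2Half} (h : φ₁ =ᵐ[halfLine] fun k => (k : ℂ) * φ k) :
    IsWeakDeriv (isPlancherelKernel_cos.op φ) (-isPlancherelKernel_sin.op φ₁) := by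
  simpa using isWeakDeriv_op isPlancherelKernel_cos isPlancherelKernel_sin (ε := -1)
    (fun y => by simpa using Real.hasDerivAt_cos y) h

theorem IsPlancherelKernel.hasTrace_op {κ : ℝ → ℝ} (hκ : IsPlancherelKernel κ) {φ : L2Half}
    (hφ : Integrable φ halfLine) : HasTrace (hκ.op φ) (trigInt κ φ 0) :=
  ⟨_, (hκ.continuous_trigInt hφ).continuousOn, hκ.op_coe_of_integrable hφ, rfl⟩

theorem hasTrace_sin {φ : L2Half} (hφ : Integrable φ halfLine) :
    HasTrace (isPlancherelKernel_sin.op φ) 0 := by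
  simpa [trigInt] using isPlancherelKernel_sin.hasTrace_op hφ

/-- If `φ` and `k²φ` are square integrable on the half-line, then `kφ` is square integrable, and
`φ` and `kφ` are integrable. -/
theorem exists_mul_id_of_sq {φ φ₂ : L2Half}
    (h : φ₂ =ᵐ[halfLine] fun k => (k : ℂ) ^ 2 * φ k) :
    ∃ φ₁ : L2Half, (φ₁ =ᵐ[halfLine] fun k => (k : ℂ) * φ k) ∧
      (φ₂ =ᵐ[halfLine] fun k => (k : ℂ) * φ₁ k) ∧
      Integrable φ halfLine ∧ Integrable φ₁ halfLine := by
  have hg : MemLp (fun k : ℝ => ((1 + k ^ 2)⁻¹ : ℝ)) 2 halfLine := by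
    refine MemLp.restrict _ ?_
    refine (memLp_two_iff_integrable_sq (by fun_prop)).2 ?_
    refine integrable_inv_one_add_sq.mono' (by fun_prop) (Eventually.of_forall fun k => ?_)
    have h1 : (1 + k ^ 2)⁻¹ ≤ 1 := inv_le_one_of_one_le₀ (by nlinarith [sq_nonneg k])
    have h2 : 0 ≤ (1 + k ^ 2)⁻¹ := by positivity
    rw [Real.norm_eq_abs, abs_of_nonneg (by positivity)]
    nlinarith
  have hkg : MemLp (fun k : ℝ => k * (1 + k ^ 2)⁻¹) 2 halfLine := by
    refine MemLp.restrict _ ?_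
    refine (memLp_two_iff_integrable_sq (by fun_prop)).2 ?_
    refine integrable_inv_one_add_sq.mono' (by fun_prop) (Eventually.of_forall fun k => ?_)
    have h2 : 0 ≤ (1 + k ^ 2)⁻¹ := by positivity
    have h3 : (1 + k ^ 2) * (1 + k ^ 2)⁻¹ = 1 := mul_inv_cancel₀ (by positivity)
    rw [Real.norm_eq_abs, abs_of_nonneg (by positivity)]
    nlinarith [mul_nonneg h2 h2]
  have hs : MemLp (fun k => φ k + φ₂ k) 2 halfLine := (Lp.memLp φ).add (Lp.memLp φ₂)
  have hne : ∀ k : ℝ, (1 + (k : ℂ) ^ 2) ≠ 0 := by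
    intro k
    have : (1 + k ^ 2 : ℝ) ≠ 0 := by positivity
    exact_mod_cast this
  have hφ : Integrable φ halfLine := by
    refine (memLp_one_iff_integrable.1 (hs.smul (p := 2) (q := 2) (r := 1) hg)).congr ?_
    filter_upwards [h] with k hk
    simp only [Pi.smul_apply', hk, Complex.real_smul]
    have := hne k
    push_cast
    field_simp
  have hkφ : Integrable (fun k : ℝ => (k : ℂ) * φ k) halfLine := by
    refine (memLp_one_iff_integrable.1 (hs.smul (p := 2) (q := 2) (r := 1) hkg)).congr ?_
    filter_upwards [h] with k hk
    simp only [Pi.smul_apply', hk, Complex.real_smul]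
    have := hne k
    push_cast
    field_simp
  have hm : MemLp (fun k : ℝ => (k : ℂ) * φ k) 2 halfLine := by
    refine MemLp.of_le (g := fun k => ‖φ k‖ + ‖φ₂ k‖)
      ((Lp.memLp φ).norm.add (Lp.memLp φ₂).norm) hkφ.aestronglyMeasurable ?_
    filter_upwards [h] with k hk
    refine le_trans ?_ (le_abs_self _)
    rw [hk, norm_mul, norm_mul, norm_pow, Complex.norm_real, Real.norm_eq_abs, ← one_add_mul]
    gcongr
    nlinarith [sq_nonneg (|k| - 1), sq_nonneg |k|]
  refine ⟨hm.toLp _, hm.coeFn_toLp, ?_, hφ, hkφ.congr hm.coeFn_toLp.symm⟩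
  filter_upwards [h, hm.coeFn_toLp] with k h1 h2
  rw [h1, h2]
  ring

/-! ### Integration by parts on the half-line -/

/-- A smooth transition from `0` on `(-∞, 1]` to `1` on `[2, ∞)`. -/
noncomputable def step (x : ℝ) : ℝ := Real.smoothTransition (x - 1)

theorem contDiff_step : ContDiff ℝ ∞ step :=
  Real.smoothTransition.contDiff.comp (contDiff_id.sub contDiff_const)

theorem step_of_le {x : ℝ} (h : x ≤ 1) : step x = 0 :=
  Real.smoothTransition.zero_of_nonpos (by linarith)

theorem step_of_ge {x : ℝ} (h : 2 ≤ x) : step x = 1 :=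
  Real.smoothTransition.one_of_one_le (by linarith)

theorem step_nonneg (x : ℝ) : 0 ≤ step x := Real.smoothTransition.nonneg _

theorem step_le_one (x : ℝ) : step x ≤ 1 := Real.smoothTransition.le_one _

theorem hasDerivAt_step (x : ℝ) : HasDerivAt step (deriv step x) x :=
  (contDiff_step.differentiable (by simp) x).hasDerivAt

theorem deriv_step_of_lt {x : ℝ} (h : x < 1) : deriv step x = 0 := by
  have : step =ᶠ[𝓝 x] fun _ => 0 := by
    filter_upwards [Iio_mem_nhds h] with y hy using step_of_le (le_of_lt hy)
  rw [this.deriv_eq]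
  simp

theorem deriv_step_of_gt {x : ℝ} (h : 2 < x) : deriv step x = 0 := by
  have : step =ᶠ[𝓝 x] fun _ => 1 := by
    filter_upwards [Ioi_mem_nhds h] with y hy using step_of_ge (le_of_lt hy)
  rw [this.deriv_eq]
  simp

theorem exists_deriv_step_bound : ∃ M : ℝ, 0 ≤ M ∧ ∀ x, |deriv step x| ≤ M := by
  have hc : HasCompactSupport (deriv step) := by
    refine HasCompactSupport.intro (isCompact_Icc (a := (1 : ℝ)) (b := 2)) fun x hx => ?_
    rw [mem_Icc, not_and_or, not_le, not_le] at hx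
    exact hx.elim deriv_step_of_lt deriv_step_of_gt
  obtain ⟨M, hM⟩ := hc.exists_bound_of_continuous (contDiff_step.continuous_deriv (by simp))
  exact ⟨M, (norm_nonneg _).trans (hM 0), hM⟩

/-- The cutoff that vanishes outside `[1/N, 2N]` and equals `1` on `[2/N, N]`. -/
noncomputable def cutoff (N x : ℝ) : ℝ := step (N * x) * (1 - step (x / N))

theorem contDiff_cutoff (N : ℝ) : ContDiff ℝ ∞ (cutoff N) := by
  have h1 : ContDiff ℝ ∞ fun x : ℝ => step (N * x) :=
    contDiff_step.comp (contDiff_const.mul contDiff_id)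
  have h2 : ContDiff ℝ ∞ fun x : ℝ => step (x / N) :=
    contDiff_step.comp (contDiff_id.div_const N)
  exact h1.mul (contDiff_const.sub h2)

theorem abs_cutoff_le (N x : ℝ) : |cutoff N x| ≤ 1 := by
  have h1 := step_nonneg (N * x)
  have h2 := step_le_one (N * x)
  have h3 := step_nonneg (x / N)
  have h4 := step_le_one (x / N)
  rw [cutoff, abs_of_nonneg (by apply mul_nonneg <;> linarith)]
  exact mul_le_one₀ h2 (by linarith) (by linarith)

theorem cutoff_eq_zero {N : ℝ} (hN : 0 < N) {x : ℝ} (hx : x ∉ Icc (1 / N) (2 * N)) :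
    cutoff N x = 0 := by
  rw [mem_Icc, not_and_or, not_le, not_le, lt_div_iff₀ hN] at hx
  rcases hx with hx | hx
  · rw [cutoff, step_of_le (by linarith), zero_mul]
  · rw [cutoff, step_of_ge (x := x / N) (by rw [le_div_iff₀ hN]; linarith), sub_self, mul_zero]

theorem tendsto_cutoff {x : ℝ} (hx : 0 < x) : Tendsto (fun N => cutoff N x) atTop (𝓝 1) := by
  apply tendsto_const_nhds.congr'
  filter_upwards [eventually_ge_atTop (2 / x), eventually_ge_atTop x, eventually_gt_atTop 0]
    with N h1 h2 h3
  rw [div_le_iff₀ hx] at h1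
  rw [cutoff, step_of_ge h1, step_of_le (x := x / N) (by rw [div_le_iff₀ h3]; linarith)]
  ring

theorem abs_deriv_cutoff_le {M : ℝ} (hM : ∀ x, |deriv step x| ≤ M) {N : ℝ} (hN : 0 < N) (x : ℝ) :
    |deriv (cutoff N) x| ≤ (if x ≤ 2 / N then N * M else 0) + M / N := by
  have h1 : HasDerivAt (fun x => step (N * x)) (deriv step (N * x) * N) x := by
    have h := (hasDerivAt_step (N * x)).comp x ((hasDerivAt_id x).const_mul N)
    rw [mul_one] at h
    exact h
  have h2 : HasDerivAt (fun x => step (x / N)) (deriv step (x / N) * (1 / N)) x := by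
    have h := (hasDerivAt_step (x / N)).comp x ((hasDerivAt_id x).div_const N)
    exact h
  have h3 : HasDerivAt (cutoff N) (deriv step (N * x) * N * (1 - step (x / N)) +
      step (N * x) * -(deriv step (x / N) * (1 / N))) x := h1.mul (h2.const_sub 1)
  rw [h3.deriv]
  have a1 := step_nonneg (N * x)
  have a2 := step_le_one (N * x)
  have a3 := step_nonneg (x / N)
  have a4 := step_le_one (x / N)
  have hM0 : 0 ≤ M := (abs_nonneg _).trans (hM 0)
  refine (abs_add_le _ _).trans (add_le_add ?_ ?_)
  · split_ifs with h
    · rw [abs_mul, abs_mul, abs_of_pos hN, abs_of_nonneg (a := 1 - step (x / N)) (by linarith),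
        mul_comm N M]
      exact mul_le_of_le_one_right (by positivity) (by linarith) |>.trans
        (mul_le_mul_of_nonneg_right (hM _) hN.le)
    · rw [not_le, div_lt_iff₀ hN] at h
      rw [deriv_step_of_gt (by linarith)]
      simp
  · rw [abs_mul, abs_of_nonneg a1, abs_neg, abs_mul, abs_of_pos (a := 1 / N) (by positivity),
      div_eq_mul_one_div M N]
    refine (mul_le_of_le_one_left (by positivity) a2).trans ?_
    exact mul_le_mul_of_nonneg_right (hM _) (by positivity)

/-- Integration by parts on the half-line, when the boundary term at `0` vanishes. -/
theorem IsWeakDeriv.integral_deriv_smul {f f' : L2Half} (hf : IsWeakDeriv f f') {u : ℝ → ℂ}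
    (hu : ContinuousOn u (Ici (0 : ℝ))) (hfu : f =ᵐ[halfLine] u) {g : ℝ → ℝ}
    (hg : ContDiff ℝ ∞ g) (hg2 : MemLp g 2 halfLine) (hg2' : MemLp (deriv g) 2 halfLine)
    (h0 : g 0 • u 0 = 0) :
    ∫ x, deriv g x • f x ∂halfLine = - ∫ x, g x • f' x ∂halfLine := by
  have hint : ∀ {g : ℝ → ℝ} (_ : MemLp g 2 halfLine) (f : L2Half),
      Integrable (fun x => g x • f x) halfLine := fun hg f =>
    memLp_one_iff_integrable.1 ((Lp.memLp f).smul (p := 2) (q := 2) (r := 1) hg)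
  obtain ⟨M, hM0, hM⟩ := exists_deriv_step_bound
  -- the weak derivative tested on the truncations of `g`
  have hcut : ∀ N : ℝ, 0 < N → ∫ x, cutoff N x • (deriv g x • f x) ∂halfLine
      + ∫ x, deriv (cutoff N) x • (g x • f x) ∂halfLine
      = - ∫ x, cutoff N x • (g x • f' x) ∂halfLine := by
    intro N hN
    have hφ : IsRealTest fun x => cutoff N x * g x := by
      have hs : ∀ x, x ∉ Icc (1 / N) (2 * N) → cutoff N x * g x = 0 := fun x hx => by
        rw [cutoff_eq_zero hN hx, zero_mul]
      refine ⟨(contDiff_cutoff N).mul hg, HasCompactSupport.intro isCompact_Icc hs, ?_⟩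
      refine (closure_minimal (fun x hx => ?_) isClosed_Icc :
        tsupport (fun x => cutoff N x * g x) ⊆ Icc (1 / N) (2 * N)).trans fun x hx => ?_
      · by_contra h
        exact hx (hs x h)
      · exact lt_of_lt_of_le (by positivity) hx.1
    have hd : ∀ x, deriv (fun x => cutoff N x * g x) x
        = deriv (cutoff N) x * g x + cutoff N x * deriv g x := fun x =>
      deriv_fun_mul ((contDiff_cutoff N).differentiable (by simp) x)
        (hg.differentiable (by simp) x)
    have h := hf _ hφ.1 hφ.2.1 hφ.2.2
    simp only [hd, add_smul, mul_smul] at h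
    rw [← h, add_comm, integral_add]
    · refine (hint hg2 f).bdd_smul (𝕜 := ℝ) (φ := deriv (cutoff N)) (N * M + M / N)
        ((contDiff_cutoff N).continuous_deriv (by simp)).aestronglyMeasurable
        (Eventually.of_forall fun x => (abs_deriv_cutoff_le hM hN x).trans ?_)
      split_ifs
      · exact le_rfl
      · simp only [zero_add, le_add_iff_nonneg_left]
        positivity
    · exact (hint hg2' f).bdd_smul (𝕜 := ℝ) (φ := cutoff N) 1
        (contDiff_cutoff N).continuous.aestronglyMeasurable
        (Eventually.of_forall fun x => abs_cutoff_le N x)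
  have hlim : ∀ {F : ℝ → ℂ}, Integrable F halfLine →
      Tendsto (fun N => ∫ x, cutoff N x • F x ∂halfLine) atTop (𝓝 (∫ x, F x ∂halfLine)) := by
    intro F hF
    refine tendsto_integral_filter_of_dominated_convergence (fun x => ‖F x‖)
      (Eventually.of_forall fun N => ?_) (Eventually.of_forall fun N => ?_) hF.norm ?_
    · exact (contDiff_cutoff N).continuous.aestronglyMeasurable.smul hF.aestronglyMeasurable
    · refine Eventually.of_forall fun x => ?_
      rw [norm_smul]
      exact mul_le_of_le_one_left (norm_nonneg _) (abs_cutoff_le N x)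
    · refine (ae_restrict_iff' measurableSet_Ioi).2 (Eventually.of_forall fun x hx => ?_)
      simpa using (tendsto_cutoff hx).smul_const (F x)
  have hbdry : Tendsto (fun N => ∫ x, deriv (cutoff N) x • (g x • f x) ∂halfLine) atTop (𝓝 0) := by
    set K := ∫ x, ‖g x • f x‖ ∂halfLine
    have hK : 0 ≤ K := integral_nonneg fun x => norm_nonneg _
    rw [Metric.tendsto_atTop]
    intro ε hε
    -- near `0` the product `g u` is small, on the scale where the derivative of the cutoff is large
    have hgu : ContinuousOn (fun x => g x • u x) (Ici (0 : ℝ)) := hg.continuous.continuousOn.smul hu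
    obtain ⟨δ, hδ, hδ'⟩ := Metric.continuousOn_iff.1 hgu 0 self_mem_Ici (ε / (4 * (M + 1)))
      (by positivity)
    refine ⟨max 1 (max (4 / δ) (4 * M * K / ε)), fun N hN => ?_⟩
    have hN1 : 1 ≤ N := (le_max_left _ _).trans hN
    have hN0 : 0 < N := by linarith
    have hN2 : 4 / δ ≤ N := (le_max_left _ _).trans ((le_max_right _ _).trans hN)
    have hN3 : 4 * M * K / ε ≤ N := (le_max_right _ _).trans ((le_max_right _ _).trans hN)
    rw [div_le_iff₀ hδ] at hN2
    rw [div_le_iff₀ hε] at hN3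
    rw [dist_zero_right]
    have hI : Integrable (indicator (Ioc 0 (2 / N)) fun _ : ℝ => N * M * (ε / (4 * (M + 1))))
        halfLine := by
      refine Integrable.restrict ?_
      exact (integrable_indicator_iff measurableSet_Ioc).2 (integrableOn_const (by simp))
    have hb : ∀ᵐ x ∂halfLine, ‖deriv (cutoff N) x • (g x • f x)‖ ≤
        indicator (Ioc 0 (2 / N)) (fun _ : ℝ => N * M * (ε / (4 * (M + 1)))) x
          + M / N * ‖g x • f x‖ := by
      have hpos : ∀ᵐ x ∂halfLine, x ∈ Ioi (0 : ℝ) := ae_restrict_mem measurableSet_Ioi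
      filter_upwards [hfu, hpos] with x hx hx0
      rw [norm_smul]
      refine (mul_le_mul_of_nonneg_right (abs_deriv_cutoff_le hM hN0 x) (norm_nonneg _)).trans ?_
      rw [add_mul]
      gcongr
      by_cases h : x ≤ 2 / N
      · rw [if_pos h, indicator_of_mem (mem_Ioc.2 ⟨hx0, h⟩)]
        gcongr
        have hx1 : x * N ≤ 2 := (le_div_iff₀ hN0).1 h
        have := hδ' x (mem_Ici.2 (le_of_lt hx0)) (by
          rw [Real.dist_eq, sub_zero, abs_of_pos hx0]
          have hx0' : 0 < x := hx0
          nlinarith)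
        rw [h0, dist_zero_right, ← hx] at this
        exact this.le
      · rw [if_neg h, indicator_of_notMem (fun h' => h h'.2), zero_mul]
    have h1 := norm_integral_le_of_norm_le (hI.add ((hint hg2 f).norm.const_mul (M / N))) hb
    refine lt_of_le_of_lt h1 ?_
    have e : ∫ x, indicator (Ioc 0 (2 / N)) (fun _ : ℝ => N * M * (ε / (4 * (M + 1)))) x ∂halfLine
        = 2 * M * (ε / (4 * (M + 1))) := by
      rw [integral_indicator measurableSet_Ioc, Measure.restrict_restrict measurableSet_Ioc,
        inter_eq_left.2 (Ioc_subset_Ioi_self : Ioc 0 (2 / N) ⊆ Ioi 0), setIntegral_const]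
      simp only [Measure.real, Real.volume_Ioc, sub_zero, smul_eq_mul]
      rw [ENNReal.toReal_ofReal (by positivity)]
      field_simp
    simp only [Pi.add_apply]
    rw [integral_add hI ((hint hg2 f).norm.const_mul (M / N)), e, integral_const_mul]
    have h2 : 2 * M * (ε / (4 * (M + 1))) < ε / 2 := by
      rw [mul_div_assoc', div_lt_div_iff₀ (by positivity) (by positivity)]
      nlinarith
    have h3 : M / N * K ≤ ε / 4 := by
      rw [div_mul_eq_mul_div, div_le_div_iff₀ (by positivity) (by positivity)]
      linarith
    change _ + M / N * K < ε
    linarith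
  have h1 := (hlim (hint hg2' f)).add hbdry
  have h2 := (hlim (hint hg2 f')).neg
  rw [add_zero] at h1
  refine tendsto_nhds_unique h1 (h2.congr' ?_)
  filter_upwards [eventually_gt_atTop 0] with N hN using (hcut N hN).symm

/-! ### From Sobolev regularity to decay of the transform -/

theorem IsRealTest.id_mul {φ : ℝ → ℝ} (h : IsRealTest φ) : IsRealTest fun x => x * φ x :=
  ⟨contDiff_id.mul h.1, h.2.1.mul_left (f := fun x => x),
    (tsupport_mul_subset_right (f := fun x : ℝ => x)).trans h.2.2⟩

/-- Differentiation under the integral sign. -/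
theorem hasDerivAt_trigInt {κ ρ : ℝ → ℝ} (hκ : IsPlancherelKernel κ) (hρ : IsPlancherelKernel ρ)
    {ε : ℝ} (hd : ∀ y, HasDerivAt κ (ε * ρ y) y) {φ : ℝ → ℝ} (hφ : IsRealTest φ) (k : ℝ) :
    HasDerivAt (trigInt κ fun x => (φ x : ℂ))
      (ε * trigInt ρ (fun x => ((x * φ x : ℝ) : ℂ)) k) k := by
  have hi : Integrable (fun x => (φ x : ℂ)) halfLine :=
    (testFun.integrable ⟨_, hφ.ofReal_mem⟩).integrableOn
  have hi' : Integrable (fun x => ((x * φ x : ℝ) : ℂ)) halfLine :=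
    (testFun.integrable ⟨_, hφ.id_mul.ofReal_mem⟩).integrableOn
  have h := (hasDerivAt_integral_of_dominated_loc_of_deriv_le (μ := halfLine) (x₀ := k)
    (F := fun k x => (κ (k * x) : ℂ) * (φ x : ℂ)) (s := univ)
    (F' := fun k x => (ε : ℂ) * ((ρ (k * x) : ℂ) * ((x * φ x : ℝ) : ℂ)))
    (bound := fun x => |ε| * ‖((x * φ x : ℝ) : ℂ)‖) univ_mem
    (Eventually.of_forall fun k => (hκ.integrable_mul hi k).aestronglyMeasurable)
    (hκ.integrable_mul hi k) ((hρ.integrable_mul hi' k).const_mul _).aestronglyMeasurable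
    (Eventually.of_forall fun x k _ => ?_) (hi'.norm.const_mul _)
    (Eventually.of_forall fun x k _ => ?_)).2
  · rw [integral_const_mul] at h
    have h2 := h.const_mul (2 / (Real.sqrt (2 * Real.pi) : ℂ))
    rw [mul_left_comm] at h2
    exact h2
  · rw [norm_mul, norm_mul, Complex.norm_real, Complex.norm_real, Real.norm_eq_abs]
    gcongr
    exact mul_le_of_le_one_left (norm_nonneg _) (hρ.bound _)
  · have h1 := (hd (k * x)).comp k ((hasDerivAt_id k).mul_const x)
    have h2 := h1.ofReal_comp.mul_const (φ x : ℂ)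
    refine h2.congr_deriv ?_
    push_cast
    ring

/-- Derivatives of the transforms are transforms of test functions again, so they are smooth. -/
theorem contDiff_trigInt {κ ρ : ℝ → ℝ} (hκ : IsPlancherelKernel κ) (hρ : IsPlancherelKernel ρ)
    {ε δ : ℝ} (hd : ∀ y, HasDerivAt κ (ε * ρ y) y) (hd' : ∀ y, HasDerivAt ρ (δ * κ y) y)
    {φ : ℝ → ℝ} (hφ : IsRealTest φ) : ContDiff ℝ ∞ (trigInt κ fun x => (φ x : ℂ)) := by
  have key : ∀ n : ℕ, ∀ φ : ℝ → ℝ, IsRealTest φ →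
      ContDiff ℝ n (trigInt κ fun x => (φ x : ℂ)) ∧
        ContDiff ℝ n (trigInt ρ fun x => (φ x : ℂ)) := by
    intro n
    induction n with
    | zero =>
      intro φ hφ
      have hi : Integrable (fun x => (φ x : ℂ)) halfLine :=
        (testFun.integrable ⟨_, hφ.ofReal_mem⟩).integrableOn
      exact ⟨contDiff_zero.2 (hκ.continuous_trigInt hi), contDiff_zero.2 (hρ.continuous_trigInt hi)⟩
    | succ n ih =>
      intro φ hφ
      have h1 := hasDerivAt_trigInt hκ hρ hd hφ
      have h2 := hasDerivAt_trigInt hρ hκ hd' hφ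
      obtain ⟨k1, k2⟩ := ih _ hφ.id_mul
      push_cast
      refine ⟨contDiff_succ_iff_deriv.2 ⟨fun k => (h1 k).differentiableAt, by simp, ?_⟩,
        contDiff_succ_iff_deriv.2 ⟨fun k => (h2 k).differentiableAt, by simp, ?_⟩⟩
      · rw [show deriv _ = _ from funext fun k => (h1 k).deriv]
        exact contDiff_const.mul k2
      · rw [show deriv _ = _ from funext fun k => (h2 k).deriv]
        exact contDiff_const.mul k1
  exact contDiff_infty.2 fun n => (key n φ hφ).1

theorem ofReal_re_trigInt (κ φ : ℝ → ℝ) (k : ℝ) :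
    ((trigInt κ (fun x => (φ x : ℂ)) k).re : ℂ) = trigInt κ (fun x => (φ x : ℂ)) k := by
  rw [← Complex.conj_eq_iff_re, IsPlancherelKernel.conj_trigInt]
  simp

/-- If `κ' = ε ρ` and `f` has a weak derivative `f'`, then the `κ`-transform of `f'` is `-ε k`
times the `ρ`-transform of `f`, provided that the boundary term `κ(0) f(0)` vanishes. -/
theorem IsWeakDeriv.op_ae_eq {κ ρ : ℝ → ℝ} (hκ : IsPlancherelKernel κ) (hρ : IsPlancherelKernel ρ)
    {ε δ : ℝ} (hd : ∀ y, HasDerivAt κ (ε * ρ y) y) (hd' : ∀ y, HasDerivAt ρ (δ * κ y) y)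
    {f f' : L2Half} (hf : IsWeakDeriv f f') {a : ℂ} (ha : HasTrace f a) (h0 : κ 0 * a = 0) :
    hκ.op f' =ᵐ[halfLine] fun k => -((ε * k : ℝ) : ℂ) * hρ.op f k := by
  obtain ⟨u, hu, hfu, rfl⟩ := ha
  have hli : LocallyIntegrable (fun k => -((ε * k : ℝ) : ℂ) * hρ.op f k) halfLine := by
    have h := (locallyIntegrable_L2 (hρ.op f)).locallyIntegrableOn univ
    rw [← locallyIntegrableOn_univ]
    refine h.continuousOn_mul (g := fun k : ℝ => -((ε * k : ℝ) : ℂ)) ?_ isOpen_univ.isLocallyClosed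
    exact Continuous.continuousOn (by fun_prop)
  refine ae_eq_of_integral_test (locallyIntegrable_L2 _) hli fun φ hφ => ?_
  set g : ℝ → ℝ := fun k => (trigInt κ (fun x => (φ x : ℂ)) k).re with hg
  set g' : ℝ → ℝ := fun k => (trigInt ρ (fun x => ((x * φ x : ℝ) : ℂ)) k).re with hg'
  have hgd : ∀ k, HasDerivAt g (ε * g' k) k := by
    intro k
    have h := hasDerivAt_trigInt hκ hρ hd hφ k
    rw [← ofReal_re_trigInt] at h
    have h2 := (Complex.reCLM.hasFDerivAt.comp_hasDerivAt k h)
    exact h2.congr_deriv (by simp [hg'])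
  have hgs : ContDiff ℝ ∞ g := Complex.reCLM.contDiff.comp (contDiff_trigInt hκ hρ hd hd' hφ)
  have hderiv : deriv g = fun k => ε * g' k := funext fun k => (hgd k).deriv
  have hg2 : MemLp g 2 halfLine := (hκ.memLp ⟨_, hφ.ofReal_mem⟩).re
  have hg2' : MemLp (deriv g) 2 halfLine := by
    rw [hderiv]
    exact (hρ.memLp ⟨_, hφ.id_mul.ofReal_mem⟩).re.const_mul ε
  have hg0 : g 0 • u 0 = 0 := by
    rw [Complex.real_smul, hg, ofReal_re_trigInt, trigInt]
    simp only [zero_mul]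
    rw [integral_const_mul, mul_assoc, mul_right_comm, h0]
    simp
  have h := hf.integral_deriv_smul hu hfu hgs hg2 hg2' hg0
  have e1 : ∫ k, φ k • hκ.op f' k ∂halfLine = ∫ x, g x • f' x ∂halfLine := by
    rw [hκ.integral_test_op hφ, inner_of_ae_real]
    filter_upwards [hκ.op_testToL2_coe ⟨_, hφ.ofReal_mem⟩] with k hk
    rw [hk, hg, ofReal_re_trigInt]
  have e2 : ∫ k, (k * φ k) • hρ.op f k ∂halfLine = ∫ x, g' x • f x ∂halfLine := by
    rw [hρ.integral_test_op hφ.id_mul, inner_of_ae_real]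
    filter_upwards [hρ.op_testToL2_coe ⟨_, hφ.id_mul.ofReal_mem⟩] with k hk
    rw [hk, hg', ofReal_re_trigInt]
  have e3 : ∫ x, deriv g x • f x ∂halfLine = ε * ∫ x, g' x • f x ∂halfLine := by
    rw [hderiv, ← integral_const_mul]
    congr 1
    ext x
    simp [mul_assoc]
  have e4 : ∫ x, φ x • (-((ε * x : ℝ) : ℂ) * hρ.op f x) ∂halfLine
      = -(ε * ∫ k, (k * φ k) • hρ.op f k ∂halfLine) := by
    rw [← integral_const_mul, ← integral_neg]
    congr 1
    ext x
    simp
    ring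
  rw [e1, e4, e2, ← e3, h, neg_neg]

theorem IsWeakDeriv.sin_ae_eq {f f' : L2Half} (hf : IsWeakDeriv f f') {a : ℂ} (ha : HasTrace f a) :
    isPlancherelKernel_sin.op f' =ᵐ[halfLine] fun k => -(k * isPlancherelKernel_cos.op f k) := by
  simpa using hf.op_ae_eq isPlancherelKernel_sin isPlancherelKernel_cos (ε := 1) (δ := -1)
    (fun y => by simpa using Real.hasDerivAt_sin y) (fun y => by simpa using Real.hasDerivAt_cos y)
    ha (by simp)

theorem IsWeakDeriv.cos_ae_eq {f f' : L2Half} (hf : IsWeakDeriv f f') (ha : HasTrace f 0) :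
    isPlancherelKernel_cos.op f' =ᵐ[halfLine] fun k => k * isPlancherelKernel_sin.op f k := by
  simpa using hf.op_ae_eq isPlancherelKernel_cos isPlancherelKernel_sin (ε := -1) (δ := 1)
    (fun y => by simpa using Real.hasDerivAt_cos y) (fun y => by simpa using Real.hasDerivAt_sin y)
    ha (by simp)

/-! ### The second derivative with Dirichlet or Neumann boundary condition -/

/-- The sine transform diagonalizes the second derivative with Dirichlet condition. -/
theorem dirichlet_iff {f f₂ : L2Half} :
    (∃ (f₁ : L2Half) (b : ℂ), IsWeakDeriv f f₁ ∧ IsWeakDeriv f₁ f₂ ∧ HasTrace f 0 ∧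
      HasTrace f₁ b) ↔
    isPlancherelKernel_sin.op f₂ =ᵐ[halfLine]
      fun k => -((k : ℂ) ^ 2 * isPlancherelKernel_sin.op f k) := by
  constructor
  · rintro ⟨f₁, b, h1, h2, h3, h4⟩
    filter_upwards [h1.cos_ae_eq h3, h2.sin_ae_eq h4] with k e1 e2
    rw [e2, e1]
    ring
  · intro h
    have h' : -isPlancherelKernel_sin.op f₂ =ᵐ[halfLine]
        fun k => (k : ℂ) ^ 2 * isPlancherelKernel_sin.op f k := by
      filter_upwards [h, Lp.coeFn_neg (isPlancherelKernel_sin.op f₂)] with k e1 e2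
      rw [e2, Pi.neg_apply, e1, neg_neg]
    obtain ⟨φ₁, k1, k2, k3, k4⟩ := exists_mul_id_of_sq h'
    have w1 := isWeakDeriv_sin k1
    have w2 := isWeakDeriv_cos k2
    have t1 := hasTrace_sin k3
    rw [isPlancherelKernel_sin.op_op] at w1 t1
    rw [map_neg, neg_neg, isPlancherelKernel_sin.op_op] at w2
    exact ⟨_, _, w1, w2, t1, isPlancherelKernel_cos.hasTrace_op k4⟩

/-- The cosine transform diagonalizes the second derivative with Neumann condition. -/
theorem neumann_iff {f f₂ : L2Half} :
    (∃ (f₁ : L2Half) (a : ℂ), IsWeakDeriv f f₁ ∧ IsWeakDeriv f₁ f₂ ∧ HasTrace f a ∧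
      HasTrace f₁ 0) ↔
    isPlancherelKernel_cos.op f₂ =ᵐ[halfLine]
      fun k => -((k : ℂ) ^ 2 * isPlancherelKernel_cos.op f k) := by
  constructor
  · rintro ⟨f₁, b, h1, h2, h3, h4⟩
    filter_upwards [h1.sin_ae_eq h3, h2.cos_ae_eq h4] with k e1 e2
    rw [e2, e1]
    ring
  · intro h
    have h' : -isPlancherelKernel_cos.op f₂ =ᵐ[halfLine]
        fun k => (k : ℂ) ^ 2 * isPlancherelKernel_cos.op f k := by
      filter_upwards [h, Lp.coeFn_neg (isPlancherelKernel_cos.op f₂)] with k e1 e2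
      rw [e2, Pi.neg_apply, e1, neg_neg]
    obtain ⟨φ₁, k1, k2, k3, k4⟩ := exists_mul_id_of_sq h'
    have w1 := isWeakDeriv_cos k1
    have w2 := (isWeakDeriv_sin k2).smul (-1)
    have t1 := isPlancherelKernel_cos.hasTrace_op k3
    have t2 := (hasTrace_sin k4).smul (-1)
    rw [isPlancherelKernel_cos.op_op] at w1 t1
    rw [map_neg, neg_one_smul, neg_one_smul, neg_neg, isPlancherelKernel_cos.op_op] at w2
    rw [neg_one_smul, smul_zero] at t2
    exact ⟨_, _, w1, w2, t1, t2⟩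

/-! ### Uniqueness of the group generated by an operator -/

namespace IsUnitaryGroup

variable {E : Type*} [NormedAddCommGroup E] [InnerProductSpace ℂ E] [CompleteSpace E]
  {ħ : ℝ} {H : E →ₗ.[ℂ] E} {U V : ℝ → E →L[ℂ] E}

theorem inner_map_map (hU : IsUnitaryGroup ħ H U) (t : ℝ) (ψ η : E) :
    inner ℂ (U t ψ) (U t η) = inner ℂ ψ η := by
  rw [← ContinuousLinearMap.adjoint_inner_right, ← ContinuousLinearMap.comp_apply]
  have := (Unitary.mem_iff.1 (hU.unitary t)).1
  rw [ContinuousLinearMap.star_eq_adjoint] at this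
  change inner ℂ ψ ((ContinuousLinearMap.adjoint (U t) * U t) η) = _
  rw [this]
  rfl

theorem norm_map (hU : IsUnitaryGroup ħ H U) (t : ℝ) (ψ : E) : ‖U t ψ‖ = ‖ψ‖ :=
  (LinearMap.norm_map_iff_inner_map_map (U t)).2 (hU.inner_map_map t) ψ

theorem hasDerivAt (hU : IsUnitaryGroup ħ H U) {ψ ξ : E} (h : HasDerivAt (fun t => U t ψ) ξ 0)
    (t : ℝ) : HasDerivAt (fun t => U t ψ) (U t ξ) t := by
  have h1 : HasDerivAt (fun s => U t (U (s - t) ψ)) (U t ξ) t := by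
    refine ((U t).hasFDerivAt.restrictScalars ℝ).comp_hasDerivAt t ?_
    have h3 : HasDerivAt (fun t => U t ψ) ξ (t - t) := by rwa [sub_self]
    exact h3.comp_sub_const t t
  refine h1.congr_of_eventuallyEq (Eventually.of_forall fun s => ?_)
  change U s ψ = (U t ∘L U (s - t)) ψ
  rw [← hU.add, add_sub_cancel]

theorem hasDerivAt_map (hU : IsUnitaryGroup ħ H U) {ψ ξ : E} (h : HasDerivAt (fun t => U t ψ) ξ 0)
    (t : ℝ) : HasDerivAt (fun s => U s (U t ψ)) (U t ξ) 0 := by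
  have h1 : HasDerivAt (fun s => U t (U s ψ)) (U t ξ) 0 :=
    ((U t).hasFDerivAt.restrictScalars ℝ).comp_hasDerivAt (0 : ℝ) h
  refine h1.congr_of_eventuallyEq (Eventually.of_forall fun s => ?_)
  change (U s ∘L U t) ψ = (U t ∘L U s) ψ
  rw [← hU.add, ← hU.add, add_comm]

/-- Infinitesimal generators of unitary groups are skew-symmetric. -/
theorem inner_add_inner (hU : IsUnitaryGroup ħ H U) {x y ξ ζ : E}
    (hx : HasDerivAt (fun t => U t x) ξ 0) (hy : HasDerivAt (fun t => U t y) ζ 0) :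
    inner ℂ x ζ + inner ℂ ξ y = 0 := by
  have h := hx.inner ℂ hy
  simp only [hU.inner_map_map, hU.zero] at h
  exact h.unique (hasDerivAt_const _ _)

/-- The averages of an orbit lie in the domain of the generator. -/
theorem hasDerivAt_integral (hU : IsUnitaryGroup ħ H U) (ψ : E) (r : ℝ) :
    HasDerivAt (fun t => U t (∫ s in (0 : ℝ)..r, U s ψ)) (U r ψ - ψ) 0 := by
  have hi : ∀ a b : ℝ, IntervalIntegrable (fun s => U s ψ) volume a b := fun a b =>
    (hU.continuous ψ).intervalIntegrable a b
  have e : ∀ t, U t (∫ s in (0 : ℝ)..r, U s ψ)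
      = (∫ s in (0 : ℝ)..(t + r), U s ψ) - ∫ s in (0 : ℝ)..t, U s ψ := by
    intro t
    rw [← (U t).intervalIntegral_comp_comm (hi 0 r)]
    have : ∀ s, U t (U s ψ) = U (s + t) ψ := fun s => by rw [add_comm, hU.add]; rfl
    simp_rw [this]
    rw [intervalIntegral.integral_comp_add_right (fun s => U s ψ), zero_add, add_comm r,
      intervalIntegral.integral_interval_sub_left (hi _ _) (hi _ _)]
  have hd : ∀ a, HasDerivAt (fun t => ∫ s in (0 : ℝ)..t, U s ψ) (U a ψ) a := fun a =>
    intervalIntegral.integral_hasDerivAt_right (hi _ _)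
      ((hU.continuous ψ).stronglyMeasurableAtFilter _ _) (hU.continuous ψ).continuousAt
  have h1 : HasDerivAt (fun t => ∫ s in (0 : ℝ)..(t + r), U s ψ) (U (0 + r) ψ) 0 :=
    (hd (0 + r)).comp_add_const 0 r
  have h2 := h1.sub (hd 0)
  rw [zero_add, hU.zero] at h2
  exact h2.congr_of_eventuallyEq (Eventually.of_forall e)

theorem unique (hħ : ħ ≠ 0) (hU : IsUnitaryGroup ħ H U) (hV : IsUnitaryGroup ħ H V) : U = V := by
  have hgen : ∀ {ψ ξ : E}, HasDerivAt (fun t => U t ψ) ξ 0 ↔ HasDerivAt (fun t => V t ψ) ξ 0 := by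
    intro ψ ξ
    have hc : (-(Complex.I / (ħ : ℂ))) • ((Complex.I * ħ) • ξ) = ξ := by
      rw [smul_smul]
      have : (ħ : ℂ) ≠ 0 := by exact_mod_cast hħ
      rw [show -(Complex.I / (ħ : ℂ)) * (Complex.I * ħ) = 1 by
        field_simp
        simp, one_smul]
    have h1 := hU.generator ψ ((Complex.I * ħ) • ξ)
    have h2 := hV.generator ψ ((Complex.I * ħ) • ξ)
    rw [hc] at h1 h2
    exact h1.symm.trans h2
  -- on the domain of the generator, `⟪U t ψ, V t ψ⟫` is constant
  have hdom : ∀ {ψ ξ : E}, HasDerivAt (fun t => U t ψ) ξ 0 → ∀ t, U t ψ = V t ψ := by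
    intro ψ ξ h t
    have h' := hgen.1 h
    have hd : ∀ s, HasDerivAt (fun s => inner ℂ (U s ψ) (V s ψ)) 0 s := by
      intro s
      refine ((hU.hasDerivAt h s).inner ℂ (hV.hasDerivAt h' s)).congr_deriv ?_
      exact hU.inner_add_inner (hU.hasDerivAt_map h s) (hgen.2 (hV.hasDerivAt_map h' s))
    have hconst : inner ℂ (U t ψ) (V t ψ) = inner ℂ (U 0 ψ) (V 0 ψ) :=
      is_const_of_deriv_eq_zero (f := fun s => inner ℂ (U s ψ) (V s ψ))
        (fun s => (hd s).differentiableAt) (fun s => (hd s).deriv) t 0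
    rw [hU.zero, hV.zero] at hconst
    have h3 : ‖U t ψ - V t ψ‖ ^ 2 = 0 := by
      rw [@norm_sub_sq ℂ, hconst, hU.norm_map, hV.norm_map]
      simp only [one_apply_eq_self, inner_self_eq_norm_sq]
      ring
    exact sub_eq_zero.1 (norm_eq_zero.1 (pow_eq_zero_iff two_ne_zero |>.1 h3))
  funext t
  ext1 ψ
  have hlim : Tendsto (fun r : ℝ => r⁻¹ • ∫ s in (0 : ℝ)..r, U s ψ) (𝓝[≠] 0) (𝓝 ψ) := by
    have hd : HasDerivAt (fun r => ∫ s in (0 : ℝ)..r, U s ψ) (U 0 ψ) 0 :=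
      intervalIntegral.integral_hasDerivAt_right ((hU.continuous ψ).intervalIntegrable _ _)
        ((hU.continuous ψ).stronglyMeasurableAtFilter _ _) (hU.continuous ψ).continuousAt
    have := hasDerivAt_iff_tendsto_slope_zero.1 hd
    simpa [hU.zero] using this
  have h1 := ((U t).continuous.tendsto ψ).comp hlim
  have h2 := ((V t).continuous.tendsto ψ).comp hlim
  refine tendsto_nhds_unique h1 (h2.congr fun r => ?_)
  simp only [Function.comp_apply]
  rw [(U t).map_smul_of_tower, (V t).map_smul_of_tower, hdom (hU.hasDerivAt_integral ψ r) t]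

theorem existsUnique (hħ : ħ ≠ 0) (hU : IsUnitaryGroup ħ H U) : ∃! U, IsUnitaryGroup ħ H U :=
  ⟨U, hU, fun _ hV => unique hħ hV hU⟩

theorem unitaryGroup_eq (hħ : ħ ≠ 0) (hU : IsUnitaryGroup ħ H U) : unitaryGroup ħ H = U :=
  unique hħ (Classical.epsilon_spec (p := IsUnitaryGroup ħ H) ⟨U, hU⟩) hU

end IsUnitaryGroup

/-! ### The free evolution in momentum space -/

/-- `F : ℝ → E` has derivative `ξ` at `0`, expressed through complex scalars. On `L²` spaces this
avoids comparing the two real vector space structures, the one of the space itself and the one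
obtained by restriction of scalars. -/
def HasDerivAtZero {E : Type*} [NormedAddCommGroup E] [NormedSpace ℂ E] (F : ℝ → E) (ξ : E) :
    Prop :=
  Tendsto (fun t : ℝ => ((t⁻¹ : ℝ) : ℂ) • (F t - F 0)) (𝓝[≠] 0) (𝓝 ξ)

theorem hasDerivAt_iff_hasDerivAtZero {E : Type*} [NormedAddCommGroup E] [InnerProductSpace ℂ E]
    {F : ℝ → E} {ξ : E} : HasDerivAt F ξ 0 ↔ HasDerivAtZero F ξ := by
  rw [hasDerivAt_iff_tendsto_slope_zero, HasDerivAtZero]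
  simp only [zero_add, Complex.coe_smul]

theorem HasDerivAtZero.map {E E' : Type*} [NormedAddCommGroup E] [NormedSpace ℂ E]
    [NormedAddCommGroup E'] [NormedSpace ℂ E'] {F : ℝ → E} {ξ : E} (h : HasDerivAtZero F ξ)
    (A : E →L[ℂ] E') : HasDerivAtZero (fun t => A (F t)) (A ξ) := by
  refine ((A.continuous.tendsto ξ).comp h).congr fun t => ?_
  rw [Function.comp_apply, map_smul, map_sub]

theorem HasDerivAtZero.add {E : Type*} [NormedAddCommGroup E] [NormedSpace ℂ E] {F G : ℝ → E}
    {ξ ζ : E} (hF : HasDerivAtZero F ξ) (hG : HasDerivAtZero G ζ) :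
    HasDerivAtZero (fun t => F t + G t) (ξ + ζ) := by
  refine (Tendsto.add hF hG).congr fun t => ?_
  rw [← smul_add, add_sub_add_comm]

theorem HasDerivAtZero.comp_mul {E : Type*} [NormedAddCommGroup E] [NormedSpace ℂ E] {F : ℝ → E}
    {ξ : E} (h : HasDerivAtZero F ξ) {c : ℝ} (hc : c ≠ 0) :
    HasDerivAtZero (fun t => F (c * t)) ((c : ℂ) • ξ) := by
  have hl : Tendsto (fun t : ℝ => c * t) (𝓝[≠] 0) (𝓝[≠] 0) := by
    refine tendsto_nhdsWithin_iff.2 ⟨?_, ?_⟩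
    · have := ((continuous_const_mul c).tendsto 0).mono_left (nhdsWithin_le_nhds (s := {0}ᶜ))
      rwa [mul_zero] at this
    · filter_upwards [self_mem_nhdsWithin] with t ht using mul_ne_zero hc ht
  refine ((h.comp hl).const_smul (c : ℂ)).congr fun t => ?_
  simp only [Function.comp_apply, mul_zero, smul_smul]
  congr 1
  have : (c : ℂ) ≠ 0 := by exact_mod_cast hc
  push_cast
  field_simp

/-- Dominated convergence to zero in `L²(ℝ₊)`. -/
theorem tendsto_L2_zero_of_dominated {ι : Type*} {l : Filter ι} [l.IsCountablyGenerated]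
    {F : ι → L2Half} {f : ι → ℝ → ℂ} {B : ℝ → ℝ} (hF : ∀ i, F i =ᵐ[halfLine] f i)
    (hB : MemLp B 2 halfLine) (hb : ∀ᶠ i in l, ∀ᵐ k ∂halfLine, ‖f i k‖ ≤ B k)
    (hlim : ∀ᵐ k ∂halfLine, Tendsto (fun i => f i k) l (𝓝 0)) : Tendsto F l (𝓝 0) := by
  have hsq : ∀ i, ‖F i‖ ^ 2 = ∫ k, ‖f i k‖ ^ 2 ∂halfLine := by
    intro i
    have h1 : inner ℂ (F i) (F i) = ((∫ k, ‖f i k‖ ^ 2 ∂halfLine : ℝ) : ℂ) := by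
      rw [L2.inner_def]
      refine Eq.trans ?_ integral_ofReal
      apply integral_congr_ae
      filter_upwards [hF i] with x hx
      rw [hx, inner_self_eq_norm_sq_to_K]
      simp
    rw [inner_self_eq_norm_sq_to_K] at h1
    exact Complex.ofReal_injective (by rw [← h1]; simp)
  have h0 : Tendsto (fun i => ∫ k, ‖f i k‖ ^ 2 ∂halfLine) l (𝓝 (∫ _, (0 : ℝ) ∂halfLine)) := by
    refine tendsto_integral_filter_of_dominated_convergence (fun k => B k ^ 2)
      (Eventually.of_forall fun i => ?_) (hb.mono fun i hi => ?_)
      ((memLp_two_iff_integrable_sq hB.aestronglyMeasurable).1 hB) ?_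
    · exact ((Lp.aestronglyMeasurable (F i)).congr (hF i)).norm.pow 2
    · filter_upwards [hi] with k hk
      rw [Real.norm_eq_abs, abs_of_nonneg (by positivity)]
      gcongr
    · filter_upwards [hlim] with k hk
      simpa using (hk.norm.pow 2)
  simp_rw [← hsq] at h0
  rw [integral_zero] at h0
  rw [tendsto_zero_iff_norm_tendsto_zero]
  have := h0.sqrt
  simpa [Real.sqrt_sq (norm_nonneg _)] using this

/-- The phase `e^{-iτk²}`. -/
noncomputable def phase (τ k : ℝ) : ℂ := Complex.exp (Complex.I * ((-(τ * k ^ 2) : ℝ) : ℂ))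

theorem norm_phase (τ k : ℝ) : ‖phase τ k‖ = 1 := by
  rw [phase, mul_comm, Complex.norm_exp_ofReal_mul_I]

theorem phase_zero (k : ℝ) : phase 0 k = 1 := by simp [phase]

theorem phase_add (s t k : ℝ) : phase (s + t) k = phase s k * phase t k := by
  rw [phase, phase, phase, ← Complex.exp_add]
  congr 1
  push_cast
  ring

theorem contDiff_phase (τ : ℝ) : ContDiff ℝ ∞ (phase τ) := by
  have h : ContDiff ℝ ∞ fun k : ℝ => ((-(τ * k ^ 2) : ℝ) : ℂ) :=
    Complex.ofRealCLM.contDiff.comp (contDiff_const.mul (contDiff_id.pow 2)).neg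
  exact (contDiff_const.mul h).cexp

theorem memLp_phase_mul (τ : ℝ) {f : ℝ → ℂ} (hf : MemLp f 2 halfLine) :
    MemLp (fun k => phase τ k * f k) 2 halfLine := by
  refine hf.of_le ((contDiff_phase τ).continuous.aestronglyMeasurable.mul hf.aestronglyMeasurable)
    (Eventually.of_forall fun k => ?_)
  rw [norm_mul, norm_phase, one_mul]

/-- Multiplication by the phase `e^{-iτk²}` on `L²(ℝ₊)`. -/
noncomputable def phaseOp (τ : ℝ) : L2Half →L[ℂ] L2Half :=
  LinearMap.mkContinuous
    { toFun := fun ψ => (memLp_phase_mul τ (Lp.memLp ψ)).toLp _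
      map_add' := fun ψ η => by
        apply Lp.ext
        filter_upwards [(memLp_phase_mul τ (Lp.memLp (ψ + η))).coeFn_toLp,
          (memLp_phase_mul τ (Lp.memLp ψ)).coeFn_toLp, (memLp_phase_mul τ (Lp.memLp η)).coeFn_toLp,
          Lp.coeFn_add ψ η, Lp.coeFn_add ((memLp_phase_mul τ (Lp.memLp ψ)).toLp _)
            ((memLp_phase_mul τ (Lp.memLp η)).toLp _)] with k h1 h2 h3 h4 h5
        rw [h1, h5, Pi.add_apply, h2, h3, h4, Pi.add_apply, mul_add]
      map_smul' := fun c ψ => by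
        apply Lp.ext
        filter_upwards [(memLp_phase_mul τ (Lp.memLp (c • ψ))).coeFn_toLp,
          (memLp_phase_mul τ (Lp.memLp ψ)).coeFn_toLp,
          Lp.coeFn_smul c ψ, Lp.coeFn_smul c ((memLp_phase_mul τ (Lp.memLp ψ)).toLp _)]
            with k h1 h2 h3 h4
        rw [h1, RingHom.id_apply, h4, Pi.smul_apply, h2, h3, Pi.smul_apply]
        simp only [smul_eq_mul]
        ring } 1 fun ψ => by
    rw [one_mul]
    refine Lp.norm_le_norm_of_ae_le ?_
    filter_upwards [(memLp_phase_mul τ (Lp.memLp ψ)).coeFn_toLp] with k h1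
    simp only [LinearMap.coe_mk, AddHom.coe_mk, h1]
    rw [norm_mul, norm_phase, one_mul]

theorem phaseOp_coe (τ : ℝ) (ψ : L2Half) :
    phaseOp τ ψ =ᵐ[halfLine] fun k => phase τ k * ψ k :=
  (memLp_phase_mul τ (Lp.memLp ψ)).coeFn_toLp

theorem phaseOp_zero : phaseOp 0 = 1 := by
  ext1 ψ
  apply Lp.ext
  filter_upwards [phaseOp_coe 0 ψ] with k h
  rw [h, phase_zero, one_mul]
  rfl

theorem phaseOp_add (s t : ℝ) : phaseOp (s + t) = phaseOp s * phaseOp t := by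
  ext1 ψ
  apply Lp.ext
  rw [mul_apply_eq_comp]
  filter_upwards [phaseOp_coe (s + t) ψ, phaseOp_coe s (phaseOp t ψ), phaseOp_coe t ψ]
    with k h1 h2 h3
  rw [h1, h2, h3, phase_add, mul_assoc]

theorem star_phaseOp (τ : ℝ) : star (phaseOp τ) = phaseOp (-τ) := by
  rw [ContinuousLinearMap.star_eq_adjoint]
  symm
  rw [ContinuousLinearMap.eq_adjoint_iff]
  intro ψ η
  rw [L2.inner_def, L2.inner_def]
  apply integral_congr_ae
  filter_upwards [phaseOp_coe (-τ) ψ, phaseOp_coe τ η] with k h1 h2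
  rw [h1, h2, RCLike.inner_apply, RCLike.inner_apply, map_mul]
  have : (starRingEnd ℂ) (phase (-τ) k) = phase τ k := by
    rw [phase, phase, ← Complex.exp_conj, map_mul, Complex.conj_I, Complex.conj_ofReal]
    congr 1
    push_cast
    ring
  rw [this]
  ring

theorem continuous_phaseOp (ψ : L2Half) : Continuous fun τ => phaseOp τ ψ := by
  rw [continuous_iff_continuousAt]
  intro t
  rw [ContinuousAt, ← tendsto_sub_nhds_zero_iff]
  refine tendsto_L2_zero_of_dominated (f := fun τ k => phase τ k * ψ k - phase t k * ψ k)
    (B := fun k => ‖ψ k‖ + ‖ψ k‖) (fun τ => ?_) ((Lp.memLp ψ).norm.add (Lp.memLp ψ).norm)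
    (Eventually.of_forall fun τ => Eventually.of_forall fun k => ?_)
    (Eventually.of_forall fun k => ?_)
  · filter_upwards [phaseOp_coe τ ψ, phaseOp_coe t ψ, Lp.coeFn_sub (phaseOp τ ψ) (phaseOp t ψ)]
      with k h1 h2 h3
    rw [h3, Pi.sub_apply, h1, h2]
  · refine (norm_sub_le _ _).trans ?_
    rw [norm_mul, norm_mul, norm_phase, norm_phase, one_mul]
  · have hc : Continuous fun τ => phase τ k * ψ k - phase t k * ψ k := by
      unfold phase
      fun_prop
    simpa using hc.tendsto t

theorem hasDerivAt_phase (k : ℝ) :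
    HasDerivAt (fun τ => phase τ k) (-(Complex.I * (k : ℂ) ^ 2)) 0 := by
  have h1 : HasDerivAt (fun τ : ℝ => ((-(τ * k ^ 2) : ℝ) : ℂ)) ((-(1 * k ^ 2) : ℝ) : ℂ) 0 :=
    ((hasDerivAt_id (0 : ℝ)).mul_const (k ^ 2)).neg.ofReal_comp
  have h2 := (h1.const_mul Complex.I).cexp
  refine h2.congr_deriv ?_
  simp

/-- The generator of the multiplication group `e^{-iτk²}` is multiplication by `-ik²` on its
maximal domain. -/
theorem hasDerivAtZero_phaseOp_iff {φ η : L2Half} :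
    HasDerivAtZero (fun τ => phaseOp τ φ) η ↔
      η =ᵐ[halfLine] fun k => -(Complex.I * (k : ℂ) ^ 2) * φ k := by
  have hs : ∀ τ : ℝ, (((τ⁻¹ : ℝ) : ℂ) • (phaseOp τ φ - phaseOp 0 φ) : L2Half)
      =ᵐ[halfLine] fun k => (τ⁻¹ • (phase τ k - phase 0 k)) * φ k := by
    intro τ
    filter_upwards [phaseOp_coe τ φ, phaseOp_coe 0 φ,
      Lp.coeFn_sub (phaseOp τ φ) (phaseOp 0 φ),
      Lp.coeFn_smul ((τ⁻¹ : ℝ) : ℂ) (phaseOp τ φ - phaseOp 0 φ)] with k h1 h2 h3 h4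
    rw [h4, Pi.smul_apply, h3, Pi.sub_apply, h1, h2, smul_mul_assoc, sub_mul, Complex.coe_smul]
  have hp : ∀ k : ℝ, Tendsto (fun τ : ℝ => (τ⁻¹ • (phase τ k - phase 0 k)) * φ k) (𝓝[≠] 0)
      (𝓝 (-(Complex.I * (k : ℂ) ^ 2) * φ k)) := fun k => by
    have := (hasDerivAt_iff_tendsto_slope_zero.1 (hasDerivAt_phase k)).mul_const (φ k)
    simpa only [zero_add] using this
  rw [HasDerivAtZero]
  constructor
  · intro h
    -- a subsequence of the difference quotients converges almost everywhere
    have hseq : Tendsto (fun n : ℕ => (1 / ((n : ℝ) + 1))) atTop (𝓝[≠] 0) :=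
      tendsto_nhdsWithin_iff.2 ⟨tendsto_one_div_add_atTop_nhds_zero_nat,
        Eventually.of_forall fun n => by
          have : (0 : ℝ) < 1 / ((n : ℝ) + 1) := by positivity
          exact this.ne'⟩
    have h1 := tendstoInMeasure_of_tendsto_Lp (h.comp hseq)
    obtain ⟨ns, hns, hae⟩ := h1.exists_seq_tendsto_ae
    have hall : ∀ᵐ k ∂halfLine, ∀ n : ℕ,
        ((((1 / ((n : ℝ) + 1))⁻¹ : ℝ) : ℂ) • (phaseOp (1 / ((n : ℝ) + 1)) φ - phaseOp 0 φ) :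
          L2Half) k = ((1 / ((n : ℝ) + 1))⁻¹ • (phase (1 / ((n : ℝ) + 1)) k - phase 0 k)) * φ k :=
      ae_all_iff.2 fun n => hs _
    filter_upwards [hae, hall] with k h2 h3
    refine tendsto_nhds_unique h2 ?_
    simp only [Function.comp_apply, h3]
    exact ((hp k).comp hseq).comp hns.tendsto_atTop
  · intro h
    rw [← tendsto_sub_nhds_zero_iff]
    refine tendsto_L2_zero_of_dominated
      (f := fun τ k => (τ⁻¹ • (phase τ k - phase 0 k)) * φ k - η k)
      (B := fun k => ‖η k‖ + ‖η k‖) (fun τ => ?_) ((Lp.memLp η).norm.add (Lp.memLp η).norm)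
      (Eventually.of_forall fun τ => ?_) ?_
    · filter_upwards [hs τ,
        Lp.coeFn_sub (((τ⁻¹ : ℝ) : ℂ) • (phaseOp τ φ - phaseOp 0 φ)) η] with k h1 h2
      rw [h2, Pi.sub_apply, h1]
    · filter_upwards [h] with k hk
      refine (norm_sub_le _ _).trans ?_
      gcongr
      rw [hk, norm_mul, norm_mul]
      gcongr
      rw [phase_zero, phase, norm_smul, norm_neg, norm_mul, Complex.norm_I, one_mul]
      rcases eq_or_ne τ 0 with rfl | hτ
      · rw [inv_zero, norm_zero, zero_mul]
        exact norm_nonneg _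
      · refine (mul_le_mul_of_nonneg_left (Real.norm_exp_I_mul_ofReal_sub_one_le)
          (norm_nonneg _)).trans ?_
        rw [norm_neg, norm_mul, ← mul_assoc, ← norm_mul, inv_mul_cancel₀ hτ]
        simp
    · filter_upwards [h] with k hk
      have := (hp k).sub_const (η k)
      rwa [← hk, sub_self] at this

/-! ### Dispersion of the free evolution -/

/-- The oscillating factor `e^{-iσ(kx + sk²)}`. -/
noncomputable def osc (σ s x k : ℝ) : ℂ :=
  Complex.exp (Complex.I * ((-(σ * (k * x + s * k ^ 2)) : ℝ) : ℂ))

theorem norm_osc (σ s x k : ℝ) : ‖osc σ s x k‖ = 1 := by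
  rw [osc, mul_comm, Complex.norm_exp_ofReal_mul_I]

theorem hasDerivAt_osc (σ s x k : ℝ) :
    HasDerivAt (osc σ s x) (-(Complex.I * σ * ((x + 2 * s * k : ℝ) : ℂ)) * osc σ s x k) k := by
  have h0 : HasDerivAt (fun k : ℝ => -(σ * (k * x + s * k ^ 2)))
      (-(σ * (1 * x + s * ((2 : ℕ) * k ^ (2 - 1) * 1)))) k :=
    ((((hasDerivAt_id k).mul_const x).add (((hasDerivAt_id k).pow 2).const_mul s)).const_mul σ).neg
  refine (h0.ofReal_comp.const_mul Complex.I).cexp.congr_deriv ?_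
  rw [osc]
  push_cast
  ring

theorem continuous_osc (σ s x : ℝ) : Continuous (osc σ s x) :=
  continuous_iff_continuousAt.2 fun k => (hasDerivAt_osc σ s x k).continuousAt

/-- Without a stationary point of the phase in the support of `f`, one integration by parts gives
decay of the oscillatory integral. -/
theorem exists_norm_integral_osc_le (f : testFun) {σ : ℝ} (hσ : σ ^ 2 = 1) :
    ∃ K d : ℝ, 0 < d ∧ 0 ≤ K ∧ ∀ s x : ℝ, 0 < s → 0 < x →
      ‖∫ k, osc σ s x k * (f : ℝ → ℂ) k ∂halfLine‖ ≤ K / (x + s * d) := by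
  obtain ⟨a, b, ha, hab, hf⟩ := testFun.exists_support f
  have hcd : Continuous (deriv (f : ℝ → ℂ)) := (testFun.contDiff f).continuous_deriv (by simp)
  obtain ⟨M, hM⟩ := (testFun.hasCompactSupport f).exists_bound_of_continuous (testFun.continuous f)
  obtain ⟨M', hM'⟩ := (testFun.hasCompactSupport f).deriv.exists_bound_of_continuous hcd
  have hM0 : 0 ≤ M := (norm_nonneg _).trans (hM 0)
  have hM0' : 0 ≤ M' := (norm_nonneg _).trans (hM' 0)
  refine ⟨(M' + M / a) * (b - a), 2 * a, by positivity,
    mul_nonneg (by positivity) (by linarith), fun s x hs hx => ?_⟩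
  have hpos : ∀ k ∈ Icc a b, 0 < x + 2 * s * k := fun k hk => by
    have : 0 < k := lt_of_lt_of_le ha hk.1
    positivity
  have hne : ∀ k ∈ Icc a b, ((x + 2 * s * k : ℝ) : ℂ) ≠ 0 := fun k hk =>
    Complex.ofReal_ne_zero.2 (hpos k hk).ne'
  set v : ℝ → ℂ := fun k => (f : ℝ → ℂ) k / ((x + 2 * s * k : ℝ) : ℂ) with hv
  set v' : ℝ → ℂ := fun k => (deriv (f : ℝ → ℂ) k * ((x + 2 * s * k : ℝ) : ℂ)
    - (f : ℝ → ℂ) k * ((2 * s : ℝ) : ℂ)) / ((x + 2 * s * k : ℝ) : ℂ) ^ 2 with hv'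
  have hdv : ∀ k ∈ Icc a b, HasDerivAt v (v' k) k := by
    intro k hk
    have h1 : HasDerivAt (f : ℝ → ℂ) (deriv (f : ℝ → ℂ) k) k :=
      ((testFun.contDiff f).differentiable (by simp) k).hasDerivAt
    have h2 : HasDerivAt (fun k : ℝ => x + 2 * s * k) (2 * s) k := by
      simpa using ((hasDerivAt_id k).const_mul (2 * s)).const_add x
    exact h1.div h2.ofReal_comp (hne k hk)
  have hvc : ContinuousOn v' (Icc a b) := by
    refine ContinuousOn.div (Continuous.continuousOn ?_) (Continuous.continuousOn (by fun_prop))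
      fun k hk => pow_ne_zero 2 (hne k hk)
    have := testFun.continuous f
    fun_prop
  have hou : uIcc a b = Icc a b := uIcc_of_le hab.le
  have hset : ∫ k, osc σ s x k * (f : ℝ → ℂ) k ∂halfLine
      = ∫ k in a..b, osc σ s x k * (f : ℝ → ℂ) k := by
    rw [setIntegral_Ioi_eq_integral fun k hk => by rw [testFun.eq_zero f hk, mul_zero],
      intervalIntegral.integral_of_le hab.le]
    symm
    refine setIntegral_eq_integral_of_forall_compl_eq_zero fun k hk => ?_
    rw [hf k fun h => hk (Ioo_subset_Ioc_self h), mul_zero]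
  have hcong : ∫ k in a..b, osc σ s x k * (f : ℝ → ℂ) k
      = Complex.I * σ * ∫ k in a..b,
        v k * (-(Complex.I * σ * ((x + 2 * s * k : ℝ) : ℂ)) * osc σ s x k) := by
    rw [← intervalIntegral.integral_const_mul]
    refine intervalIntegral.integral_congr fun k hk => ?_
    rw [hou] at hk
    have h1 := hne k hk
    have h2 : (σ : ℂ) ^ 2 = 1 := by exact_mod_cast hσ
    simp only [hv]
    field_simp
    linear_combination (osc σ s x k * (f : ℝ → ℂ) k * σ ^ 2) * Complex.I_sq +
      (-osc σ s x k * (f : ℝ → ℂ) k) * h2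
  have hparts := intervalIntegral.integral_mul_deriv_eq_deriv_mul (a := a) (b := b)
    (u := v) (v := osc σ s x) (u' := v')
    (fun k hk => hdv k (hou ▸ hk)) (fun k _ => hasDerivAt_osc σ s x k)
    ((hou.symm ▸ hvc : ContinuousOn v' (uIcc a b)).intervalIntegrable)
    (Continuous.intervalIntegrable (by have := continuous_osc σ s x; fun_prop) _ _)
  have hva : v a = 0 := by simp [hv, hf a (by simp)]
  have hvb : v b = 0 := by simp [hv, hf b (by simp)]
  rw [hset, hcong, hparts, hva, hvb, zero_mul, zero_mul, sub_zero, zero_sub, norm_mul, norm_neg,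
    norm_mul, Complex.norm_I, one_mul, Complex.norm_real]
  have hσ1 : ‖σ‖ = 1 := by
    rw [Real.norm_eq_abs, ← sq_eq_sq₀ (abs_nonneg _) zero_le_one, sq_abs, hσ, one_pow]
  rw [hσ1, one_mul]
  have hb : ∀ k ∈ uIoc a b, ‖v' k * osc σ s x k‖ ≤ (M' + M / a) / (x + s * (2 * a)) := by
    intro k hk
    rw [uIoc_of_le hab.le] at hk
    have hk' : k ∈ Icc a b := Ioc_subset_Icc_self hk
    have h1 := hpos k hk'
    have hd : 0 < x + s * (2 * a) := by positivity
    have hle : x + s * (2 * a) ≤ x + 2 * s * k := by nlinarith [hk'.1]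
    rw [norm_mul, norm_osc, mul_one, hv']
    simp only
    rw [norm_div, norm_pow, Complex.norm_real, Real.norm_eq_abs, abs_of_pos h1]
    have h2 : ‖deriv (f : ℝ → ℂ) k * ((x + 2 * s * k : ℝ) : ℂ)
        - (f : ℝ → ℂ) k * ((2 * s : ℝ) : ℂ)‖ ≤ (M' + M / a) * (x + 2 * s * k) := by
      refine (norm_sub_le _ _).trans ?_
      rw [norm_mul, norm_mul, Complex.norm_real, Complex.norm_real, Real.norm_eq_abs,
        Real.norm_eq_abs, abs_of_pos h1, abs_of_pos (by positivity : 0 < 2 * s), add_mul]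
      refine add_le_add (mul_le_mul_of_nonneg_right (hM' k) h1.le) ?_
      rw [div_mul_eq_mul_div, le_div_iff₀ ha, mul_assoc]
      refine mul_le_mul (hM k) ?_ (by positivity) hM0
      nlinarith [hk'.1]
    rw [div_le_div_iff₀ (by positivity) hd]
    calc _ ≤ ((M' + M / a) * (x + 2 * s * k)) * (x + 2 * s * k) := by gcongr
      _ = _ := by ring
  have h := intervalIntegral.norm_integral_le_of_norm_le_const hb
  rw [abs_of_pos (by linarith : 0 < b - a)] at h
  refine h.trans (le_of_eq ?_)
  ring

/-- `C - σ i S`, whose kernel is proportional to `e^{-iσkx}`. -/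
noncomputable def planeWaveOp (σ : ℝ) : L2Half →L[ℂ] L2Half :=
  isPlancherelKernel_cos.op - ((σ : ℂ) * Complex.I) • isPlancherelKernel_sin.op

theorem norm_planeWaveOp_le {σ : ℝ} (hσ : σ ^ 2 = 1) (ψ : L2Half) :
    ‖planeWaveOp σ ψ‖ ≤ 2 * ‖ψ‖ := by
  have hσ1 : ‖σ‖ = 1 := by
    rw [Real.norm_eq_abs, ← sq_eq_sq₀ (abs_nonneg _) zero_le_one, sq_abs, hσ, one_pow]
  have h := norm_sub_le (isPlancherelKernel_cos.op ψ)
    (((σ : ℂ) * Complex.I) • isPlancherelKernel_sin.op ψ)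
  refine h.trans ?_
  rw [norm_smul, norm_mul, Complex.norm_real, hσ1,
    Complex.norm_I, isPlancherelKernel_cos.norm_op, isPlancherelKernel_sin.norm_op]
  linarith

theorem norm_phaseOp (τ : ℝ) (ψ : L2Half) : ‖phaseOp τ ψ‖ = ‖ψ‖ := by
  refine le_antisymm ?_ ?_
  · refine Lp.norm_le_norm_of_ae_le ?_
    filter_upwards [phaseOp_coe τ ψ] with k h
    rw [h, norm_mul, norm_phase, one_mul]
  · refine Lp.norm_le_norm_of_ae_le ?_
    filter_upwards [phaseOp_coe τ ψ] with k h
    rw [h, norm_mul, norm_phase, one_mul]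

theorem planeWaveOp_phaseOp_coe (f : testFun) {σ : ℝ} (hσ : σ = 1 ∨ σ = -1) (s : ℝ) :
    planeWaveOp σ (phaseOp (σ * s) (testToL2 f)) =ᵐ[halfLine] fun x =>
      (2 / (Real.sqrt (2 * Real.pi) : ℂ)) * ∫ k, osc σ s x k * (f : ℝ → ℂ) k ∂halfLine := by
  have he : phaseOp (σ * s) (testToL2 f) =ᵐ[halfLine] fun k => phase (σ * s) k * (f : ℝ → ℂ) k := by
    filter_upwards [phaseOp_coe (σ * s) (testToL2 f), testToL2_coe f] with k h1 h2
    rw [h1, h2]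
  have hi0 : Integrable (fun k => phase (σ * s) k * (f : ℝ → ℂ) k) halfLine := by
    refine (testFun.integrable f).integrableOn.bdd_mul (c := 1)
      (contDiff_phase _).continuous.aestronglyMeasurable (Eventually.of_forall fun k => ?_)
    rw [norm_phase]
  have hi : Integrable (phaseOp (σ * s) (testToL2 f)) halfLine := hi0.congr he.symm
  have htrig : ∀ (κ : ℝ → ℝ) (x : ℝ), trigInt κ (phaseOp (σ * s) (testToL2 f)) x
      = trigInt κ (fun k => phase (σ * s) k * (f : ℝ → ℂ) k) x := by
    intro κ x
    rw [trigInt, trigInt]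
    congr 1
    apply integral_congr_ae
    filter_upwards [he] with k hk
    rw [hk]
  filter_upwards [isPlancherelKernel_cos.op_coe_of_integrable hi,
    isPlancherelKernel_sin.op_coe_of_integrable hi,
    Lp.coeFn_sub (isPlancherelKernel_cos.op (phaseOp (σ * s) (testToL2 f)))
      (((σ : ℂ) * Complex.I) • isPlancherelKernel_sin.op (phaseOp (σ * s) (testToL2 f))),
    Lp.coeFn_smul ((σ : ℂ) * Complex.I)
      (isPlancherelKernel_sin.op (phaseOp (σ * s) (testToL2 f)))] with x h1 h2 h3 h4
  change (isPlancherelKernel_cos.op (phaseOp (σ * s) (testToL2 f)) -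
      ((σ : ℂ) * Complex.I) • isPlancherelKernel_sin.op (phaseOp (σ * s) (testToL2 f)) : L2Half) x
    = _
  rw [h3, Pi.sub_apply, h4, Pi.smul_apply, h1, h2, htrig, htrig, trigInt, trigInt, smul_eq_mul,
    mul_left_comm, ← mul_sub, ← integral_const_mul, ← integral_sub
      (isPlancherelKernel_cos.integrable_mul hi0 x)
      ((isPlancherelKernel_sin.integrable_mul hi0 x).const_mul _)]
  congr 2
  ext k
  have hexp : osc σ s x k = (Real.cos (x * k) - (σ : ℂ) * Complex.I * Real.sin (x * k)) *
      phase (σ * s) k := by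
    have h5 : osc σ s x k = Complex.exp (((-(σ * (x * k)) : ℝ) : ℂ) * Complex.I) *
        phase (σ * s) k := by
      rw [osc, phase, ← Complex.exp_add]
      congr 1
      push_cast
      ring
    rw [h5, Complex.exp_mul_I, ← Complex.ofReal_cos, ← Complex.ofReal_sin]
    congr 1
    rcases hσ with rfl | rfl
    · simp
      ring
    · simp
      ring
  rw [hexp]
  ring

theorem memLp_inv_add {d : ℝ} (hd : 0 < d) : MemLp (fun x : ℝ => (x + d)⁻¹) 2 halfLine := by
  refine (memLp_two_iff_integrable_sq (by fun_prop)).2 ?_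
  have h := integrableOn_add_rpow_Ioi_of_lt (a := -2) (c := 0) (m := d) (by norm_num) (by linarith)
  refine Integrable.congr h ((ae_restrict_iff' measurableSet_Ioi).2
    (Eventually.of_forall fun x hx => ?_))
  have : 0 < x + d := by
    have : 0 < x := hx
    linarith
  simp only
  rw [Real.rpow_neg this.le, inv_pow, Real.rpow_two]

/-- Up to a constant, `C - σ i S` is the Fourier transform with kernel `e^{-iσkx}`, restricted to
`x > 0`. The packet `e^{-iσsk²} ψ(k)`, `k > 0`, of plane waves travels into `x < 0`. -/
theorem tendsto_planeWaveOp_phaseOp {σ : ℝ} (hσ : σ = 1 ∨ σ = -1) (ψ : L2Half) :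
    Tendsto (fun s => planeWaveOp σ (phaseOp (σ * s) ψ)) atTop (𝓝 0) := by
  have hσ2 : σ ^ 2 = 1 := by rcases hσ with rfl | rfl <;> norm_num
  have htest : ∀ f : testFun,
      Tendsto (fun s => planeWaveOp σ (phaseOp (σ * s) (testToL2 f))) atTop (𝓝 0) := by
    intro f
    obtain ⟨K, d, hd, hK, hb⟩ := exists_norm_integral_osc_le f hσ2
    set N : ℝ := ‖(2 / (Real.sqrt (2 * Real.pi) : ℂ))‖
    have hpos : ∀ᵐ x ∂halfLine, x ∈ Ioi (0 : ℝ) := ae_restrict_mem measurableSet_Ioi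
    refine tendsto_L2_zero_of_dominated (fun s => planeWaveOp_phaseOp_coe f hσ s)
      ((memLp_inv_add hd).const_mul (N * K)) ?_ ?_
    · filter_upwards [eventually_ge_atTop 1] with s hs
      filter_upwards [hpos] with x hx
      have hx0 : 0 < x := hx
      rw [norm_mul, mul_assoc]
      refine mul_le_mul_of_nonneg_left ((hb s x (by linarith) hx).trans ?_) (norm_nonneg _)
      rw [div_eq_mul_inv]
      gcongr
      nlinarith
    · filter_upwards [hpos] with x hx
      have hx0 : 0 < x := hx
      have h1 : Tendsto (fun s : ℝ => N * (K / (x + s * d))) atTop (𝓝 (N * 0)) := by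
        refine Tendsto.const_mul N (Tendsto.const_div_atTop ?_ K)
        exact tendsto_atTop_add_const_left _ _ (tendsto_id.atTop_mul_const hd)
      rw [mul_zero] at h1
      refine squeeze_zero_norm' ?_ h1
      filter_upwards [eventually_gt_atTop 0] with s hs
      rw [norm_mul]
      exact mul_le_mul_of_nonneg_left (hb s x hs hx) (norm_nonneg _)
  rw [Metric.tendsto_nhds]
  intro ε hε
  obtain ⟨f, hf⟩ := Metric.denseRange_iff.1 denseRange_testToL2 ψ (ε / 4) (by positivity)
  rw [dist_eq_norm] at hf
  filter_upwards [Metric.tendsto_nhds.1 (htest f) (ε / 2) (by positivity)] with s hs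
  rw [dist_zero_right] at hs ⊢
  have e : planeWaveOp σ (phaseOp (σ * s) ψ) = planeWaveOp σ (phaseOp (σ * s) (ψ - testToL2 f))
      + planeWaveOp σ (phaseOp (σ * s) (testToL2 f)) := by
    rw [map_sub, map_sub, sub_add_cancel]
  rw [e]
  refine lt_of_le_of_lt (norm_add_le _ _) ?_
  have h1 := norm_planeWaveOp_le hσ2 (phaseOp (σ * s) (ψ - testToL2 f))
  rw [norm_phaseOp] at h1
  linarith

/-! ### The evolution on the half-line -/

namespace IsPlancherelKernel

variable {κ : ℝ → ℝ} (hκ : IsPlancherelKernel κ)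

/-- The group on `L²(ℝ₊)` that the transform with kernel `κ` carries to multiplication by
`e^{-ictk²}`: the Dirichlet evolution for `κ = sin`, the Neumann evolution for `κ = cos`. -/
noncomputable def group (c t : ℝ) : L2Half →L[ℂ] L2Half := hκ.op * phaseOp (c * t) * hκ.op

theorem group_apply (c t : ℝ) (ψ : L2Half) :
    hκ.group c t ψ = hκ.op (phaseOp (c * t) (hκ.op ψ)) := rfl

theorem group_zero (c : ℝ) : hκ.group c 0 = 1 := by
  rw [group, mul_zero, phaseOp_zero, mul_one, hκ.op_comp_op]

theorem group_add (c s t : ℝ) : hκ.group c (s + t) = hκ.group c s * hκ.group c t := by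
  ext1 ψ
  rw [mul_apply_eq_comp, group_apply, group_apply, group_apply, hκ.op_op, mul_add, phaseOp_add]
  rfl

theorem star_group (c t : ℝ) : star (hκ.group c t) = hκ.group c (-t) := by
  rw [group, star_mul, star_mul, hκ.star_op, star_phaseOp, group, mul_neg, mul_assoc]

theorem continuous_group (c : ℝ) (ψ : L2Half) : Continuous fun t => hκ.group c t ψ :=
  hκ.op.continuous.comp ((continuous_phaseOp _).comp (continuous_const.mul continuous_id))

/-- The generator of the group is `ic` times the operator that the transform carries to
multiplication by `-k²`. -/
theorem hasDerivAtZero_group_iff {c : ℝ} (hc : c ≠ 0) {f f₂ : L2Half} :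
    HasDerivAtZero (fun t => hκ.group c t f) ((Complex.I * c) • f₂) ↔
      hκ.op f₂ =ᵐ[halfLine] fun k => -((k : ℂ) ^ 2 * hκ.op f k) := by
  have hc' : (c : ℂ) ≠ 0 := by exact_mod_cast hc
  have h1 : HasDerivAtZero (fun t => hκ.group c t f) ((Complex.I * c) • f₂) ↔
      HasDerivAtZero (fun t => phaseOp (c * t) (hκ.op f)) ((Complex.I * c) • hκ.op f₂) := by
    constructor
    · intro h
      simpa only [group_apply, hκ.op_op, map_smul] using h.map hκ.op
    · intro h
      simpa only [group_apply, hκ.op_op, map_smul] using h.map hκ.op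
  have h2 : HasDerivAtZero (fun t => phaseOp (c * t) (hκ.op f)) ((Complex.I * c) • hκ.op f₂) ↔
      HasDerivAtZero (fun τ => phaseOp τ (hκ.op f)) (Complex.I • hκ.op f₂) := by
    constructor
    · intro h
      have := h.comp_mul (inv_ne_zero hc)
      simp only [mul_inv_cancel_left₀ hc, smul_smul] at this
      rwa [show ((c⁻¹ : ℝ) : ℂ) * (Complex.I * c) = Complex.I by push_cast; field_simp] at this
    · intro h
      have := h.comp_mul hc
      rwa [smul_smul, mul_comm (c : ℂ)] at this
  rw [h1, h2, hasDerivAtZero_phaseOp_iff]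
  have hI : ∀ a b : ℂ, Complex.I * a = -(Complex.I * b) ↔ a = -b := by
    intro a b
    rw [← mul_neg, mul_right_inj' Complex.I_ne_zero]
  constructor
  · intro h
    filter_upwards [h, Lp.coeFn_smul Complex.I (hκ.op f₂)] with k e1 e2
    rw [e2, Pi.smul_apply, smul_eq_mul, neg_mul, mul_assoc, hI] at e1
    exact e1
  · intro h
    filter_upwards [h, Lp.coeFn_smul Complex.I (hκ.op f₂)] with k e1 e2
    rw [e2, Pi.smul_apply, smul_eq_mul, neg_mul, mul_assoc, hI]
    exact e1

end IsPlancherelKernel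

theorem cosAdjSin_eq :
    cosAdjSin = (-Complex.I) • (isPlancherelKernel_cos.op * isPlancherelKernel_sin.op) := by
  rw [cosAdjSin, cosineTransform_eq, sineTransform_eq, ← ContinuousLinearMap.star_eq_adjoint,
    isPlancherelKernel_cos.star_op]
  ext1 ψ
  exact map_smul isPlancherelKernel_cos.op _ _

theorem star_cosAdjSin_mul : star cosAdjSin * cosAdjSin = 1 := by
  rw [cosAdjSin_eq, star_smul, star_mul, isPlancherelKernel_cos.star_op,
    isPlancherelKernel_sin.star_op, smul_mul_smul_comm, mul_assoc,
    ← mul_assoc isPlancherelKernel_cos.op, isPlancherelKernel_cos.op_comp_op, one_mul,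
    isPlancherelKernel_sin.op_comp_op]
  simp

/-- The wave operator for the pair of the Neumann and the Dirichlet evolution on the half-line. -/
theorem tendsto_neumann_dirichlet {c : ℝ} (hc : 0 < c) {σ : ℝ} (hσ : σ = 1 ∨ σ = -1)
    (ψ : L2Half) :
    Tendsto (fun s => isPlancherelKernel_cos.group c (-(σ * s))
      (isPlancherelKernel_sin.group c (σ * s) ψ)) atTop (𝓝 ((σ : ℂ) • cosAdjSin ψ)) := by
  set C := isPlancherelKernel_cos
  set S := isPlancherelKernel_sin
  have hσ2 : (σ : ℂ) * σ = 1 := by rcases hσ with rfl | rfl <;> norm_num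
  rw [← tendsto_sub_nhds_zero_iff]
  have h := (tendsto_planeWaveOp_phaseOp hσ (S.op ψ)).comp (tendsto_id.const_mul_atTop hc)
  refine squeeze_zero_norm (fun s => le_of_eq ?_) (by simpa using h.norm)
  -- the Neumann evolution of the claimed limit is `-σ i C e^{-ictk²} S ψ`, so the difference is
  -- a unitary image of `(C - σ i S) e^{-ictk²} S ψ`
  have e1 : (σ : ℂ) • cosAdjSin ψ = C.group c (-(σ * s))
      (-(((σ : ℂ) * Complex.I) • C.op (phaseOp (c * (σ * s)) (S.op ψ)))) := by
    rw [C.group_apply, map_neg, map_smul, C.op_op, map_neg, map_smul,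
      ← mul_apply_eq_comp (phaseOp _), ← phaseOp_add, mul_neg, neg_add_cancel, phaseOp_zero,
      cosAdjSin_eq, map_neg, map_smul]
    change (σ : ℂ) • (-Complex.I) • C.op (S.op ψ) = -(((σ : ℂ) * Complex.I) • C.op (S.op ψ))
    rw [smul_smul, mul_neg, neg_smul]
  have e2 : S.group c (σ * s) ψ - -(((σ : ℂ) * Complex.I) • C.op (phaseOp (c * (σ * s)) (S.op ψ)))
      = ((σ : ℂ) * Complex.I) • planeWaveOp σ (phaseOp (σ * (c * s)) (S.op ψ)) := by
    rw [mul_left_comm c σ s]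
    change S.op (phaseOp (c * (σ * s)) (S.op ψ)) - _ = ((σ : ℂ) * Complex.I) •
      (C.op (phaseOp (σ * (c * s)) (S.op ψ)) -
        ((σ : ℂ) * Complex.I) • S.op (phaseOp (σ * (c * s)) (S.op ψ)))
    rw [mul_left_comm c σ s, smul_sub, smul_smul, mul_mul_mul_comm, hσ2, Complex.I_mul_I, one_mul,
      neg_one_smul]
    abel
  have hn : ∀ t φ, ‖C.group c t φ‖ = ‖φ‖ := fun t φ => by
    rw [C.group_apply, C.norm_op, norm_phaseOp, C.norm_op]
  rw [e1, ← map_sub, hn, e2, norm_smul, norm_mul, Complex.norm_I, Complex.norm_real]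
  have : ‖σ‖ = 1 := by rcases hσ with rfl | rfl <;> simp
  rw [this, one_mul, one_mul]

/-! ### Operators on the graph -/

section Operators

variable {E : Type*} [NormedAddCommGroup E] [InnerProductSpace ℂ E] [CompleteSpace E]

-- These instances of general identities are stated for an abstract Hilbert space because the
-- instances on `L²(𝒢)` do not unify with the general ring structures in reasonable time.

theorem star_add_operator (X Y : E →L[ℂ] E) : star (X + Y) = star X + star Y := star_add X Y

theorem star_sub_operator (X Y : E →L[ℂ] E) : star (X - Y) = star X - star Y := star_sub X Y

omit [CompleteSpace E] in
theorem mul_neg_one_operator (X : E →L[ℂ] E) : X * -1 = -X := mul_neg_one X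

end Operators

section Graph

variable {n : ℕ}

theorem directSum_mul (A B : L2Half →L[ℂ] L2Half) :
    directSum n (A * B) = directSum n A * directSum n B := rfl

theorem directSum_one : directSum n 1 = 1 := rfl

theorem directSum_add (A B : L2Half →L[ℂ] L2Half) :
    directSum n (A + B) = directSum n A + directSum n B := rfl

theorem directSum_sub (A B : L2Half →L[ℂ] L2Half) :
    directSum n (A - B) = directSum n A - directSum n B := rfl

theorem star_directSum (A : L2Half →L[ℂ] L2Half) :
    star (directSum n A) = directSum n (star A) := by
  rw [ContinuousLinearMap.star_eq_adjoint]
  symm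
  rw [ContinuousLinearMap.eq_adjoint_iff]
  intro ψ η
  rw [PiLp.inner_apply, PiLp.inner_apply]
  simp only [directSum_apply, ContinuousLinearMap.star_eq_adjoint,
    ContinuousLinearMap.adjoint_inner_left]

theorem vertexOperator_apply' (ψ : L2Graph n) (ℓ : Fin n) :
    vertexOperator n ψ ℓ = ψ ℓ - (2 / (n : ℂ)) • ∑ ℓ', ψ ℓ' := by
  rw [vertexOperator_apply]
  simp only [vertexMatrix_apply, sub_smul, Finset.sum_sub_distrib, ← Finset.smul_sum]
  simp

theorem star_vertexOperator : star (vertexOperator n) = vertexOperator n := by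
  rw [ContinuousLinearMap.star_eq_adjoint]
  symm
  rw [ContinuousLinearMap.eq_adjoint_iff]
  intro ψ η
  rw [PiLp.inner_apply, PiLp.inner_apply]
  simp only [vertexOperator_apply', inner_sub_left, inner_sub_right, Finset.sum_sub_distrib,
    inner_smul_left, inner_smul_right, sum_inner, inner_sum, ← Finset.mul_sum]
  rw [Finset.sum_comm]
  simp only [map_div₀, map_ofNat, map_natCast]

theorem vertexOperator_mul_self (hn : 0 < n) : vertexOperator n * vertexOperator n = 1 := by
  ext1 ψ
  ext1 ℓ
  have hn' : (n : ℂ) ≠ 0 := by exact_mod_cast hn.ne'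
  change vertexOperator n (vertexOperator n ψ) ℓ = ψ ℓ
  rw [vertexOperator_apply']
  simp only [vertexOperator_apply', Finset.sum_sub_distrib, Finset.sum_const, Finset.card_univ,
    Fintype.card_fin]
  rw [← Nat.cast_smul_eq_nsmul ℂ, smul_smul, mul_div_cancel₀ _ hn', two_smul]
  module

theorem commute_vertexOperator_directSum (A : L2Half →L[ℂ] L2Half) :
    Commute (vertexOperator n) (directSum n A) := by
  ext1 ψ
  ext1 ℓ
  change vertexOperator n (directSum n A ψ) ℓ = directSum n A (vertexOperator n ψ) ℓ
  rw [directSum_apply, vertexOperator_apply', vertexOperator_apply', map_sub, map_smul, map_sum]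
  rfl

variable (n) in
/-- The projection `(1 - 𝕊)/2 = J/n` onto the functions that agree on all edges. -/
noncomputable def symProj : L2Graph n →L[ℂ] L2Graph n := (1 / 2 : ℂ) • (1 - vertexOperator n)

variable (n) in
/-- The complementary projection `(1 + 𝕊)/2`, onto the functions with vanishing sum over the
edges. -/
noncomputable def antiProj : L2Graph n →L[ℂ] L2Graph n := (1 / 2 : ℂ) • (1 + vertexOperator n)

theorem symProj_apply (ψ : L2Graph n) (ℓ : Fin n) :
    symProj n ψ ℓ = (1 / (n : ℂ)) • ∑ ℓ', ψ ℓ' := by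
  change (1 / 2 : ℂ) • (ψ ℓ - vertexOperator n ψ ℓ) = _
  rw [vertexOperator_apply', sub_sub_cancel, smul_smul]
  congr 1
  ring

theorem symProj_add_antiProj : symProj n + antiProj n = 1 := by
  rw [symProj, antiProj]
  module

theorem antiProj_apply (ψ : L2Graph n) (ℓ : Fin n) :
    antiProj n ψ ℓ = ψ ℓ - (1 / (n : ℂ)) • ∑ ℓ', ψ ℓ' := by
  rw [← symProj_apply ψ ℓ, eq_sub_of_add_eq' (symProj_add_antiProj (n := n))]
  rfl

theorem symProj_mul_self (hn : 0 < n) : symProj n * symProj n = symProj n := by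
  rw [symProj, smul_mul_smul_comm, sub_mul, mul_sub, mul_sub, vertexOperator_mul_self hn]
  simp only [mul_one, one_mul]
  module

theorem antiProj_mul_self (hn : 0 < n) : antiProj n * antiProj n = antiProj n := by
  rw [antiProj, smul_mul_smul_comm, add_mul, mul_add, mul_add, vertexOperator_mul_self hn]
  simp only [mul_one, one_mul]
  module

theorem symProj_mul_antiProj (hn : 0 < n) : symProj n * antiProj n = 0 := by
  rw [symProj, antiProj, smul_mul_smul_comm, sub_mul, mul_add, mul_add, vertexOperator_mul_self hn]
  simp only [mul_one, one_mul]
  module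

theorem antiProj_mul_symProj (hn : 0 < n) : antiProj n * symProj n = 0 := by
  rw [symProj, antiProj, smul_mul_smul_comm, add_mul, mul_sub, mul_sub, vertexOperator_mul_self hn]
  simp only [mul_one, one_mul]
  module

theorem star_symProj : star (symProj n) = symProj n := by
  rw [symProj, star_smul, star_sub_operator, star_one, star_vertexOperator]
  simp

theorem star_antiProj : star (antiProj n) = antiProj n := by
  rw [antiProj, star_smul, star_add_operator, star_one, star_vertexOperator]
  simp

theorem commute_symProj (A : L2Half →L[ℂ] L2Half) : Commute (symProj n) (directSum n A) :=
  ((Commute.one_left _).sub_left (commute_vertexOperator_directSum A)).smul_left _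

theorem commute_antiProj (A : L2Half →L[ℂ] L2Half) : Commute (antiProj n) (directSum n A) :=
  ((Commute.one_left _).add_left (commute_vertexOperator_directSum A)).smul_left _

variable (n) in
/-- The operator acting as `A` on the symmetric and as `B` on the antisymmetric subspace. -/
noncomputable def blockOp (A B : L2Half →L[ℂ] L2Half) : L2Graph n →L[ℂ] L2Graph n :=
  symProj n * directSum n A + antiProj n * directSum n B

theorem blockOp_self (A : L2Half →L[ℂ] L2Half) : blockOp n A A = directSum n A := by
  rw [blockOp, ← add_mul, symProj_add_antiProj, one_mul]

theorem blockOp_mul (hn : 0 < n) (A B A' B' : L2Half →L[ℂ] L2Half) :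
    blockOp n A B * blockOp n A' B' = blockOp n (A * A') (B * B') := by
  have h : ∀ P Q : L2Graph n →L[ℂ] L2Graph n, ∀ X Y, Commute Q (directSum n X) →
      P * directSum n X * (Q * directSum n Y) = P * Q * directSum n (X * Y) := by
    intro P Q X Y hc
    rw [directSum_mul, mul_assoc, ← mul_assoc (directSum n X), ← hc.eq]
    simp only [mul_assoc]
  rw [blockOp, blockOp, blockOp, add_mul, mul_add, mul_add, h _ _ _ _ (commute_symProj _),
    h _ _ _ _ (commute_antiProj _), h _ _ _ _ (commute_symProj _), h _ _ _ _ (commute_antiProj _),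
    symProj_mul_self hn, antiProj_mul_self hn, symProj_mul_antiProj hn, antiProj_mul_symProj hn]
  simp

theorem star_blockOp (A B : L2Half →L[ℂ] L2Half) :
    star (blockOp n A B) = blockOp n (star A) (star B) := by
  rw [blockOp, star_add_operator, star_mul, star_mul, star_directSum, star_directSum, star_symProj,
    star_antiProj, ← (commute_symProj _).eq, ← (commute_antiProj _).eq, blockOp]

theorem blockOp_one : blockOp n 1 1 = 1 := by
  rw [blockOp_self, directSum_one]

theorem blockOp_neg_one_one : blockOp n (-1) 1 = vertexOperator n := by
  have : directSum n (-1) = -1 := rfl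
  rw [blockOp, directSum_one, this, mul_neg_one_operator, mul_one, symProj, antiProj]
  module

theorem blockOp_eq_half (W : L2Half →L[ℂ] L2Half) :
    blockOp n W 1 = (1 / 2 : ℂ) • directSum n (1 + W) +
      (1 / 2 : ℂ) • (vertexOperator n ∘L directSum n (1 - W)) := by
  change _ = _ + (1 / 2 : ℂ) • (vertexOperator n * directSum n (1 - W))
  rw [blockOp, directSum_one, directSum_add, directSum_sub, directSum_one, symProj, antiProj,
    smul_mul_assoc, smul_mul_assoc, sub_mul, mul_sub, mul_one, mul_one, one_mul]
  module

theorem tendsto_graph_iff {ι : Type*} {l : Filter ι} {F : ι → L2Graph n} {ψ : L2Graph n} :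
    Tendsto F l (𝓝 ψ) ↔ ∀ ℓ, Tendsto (fun i => F i ℓ) l (𝓝 (ψ ℓ)) := by
  rw [← tendsto_pi_nhds]
  constructor
  · exact fun h => ((coords n).continuous.tendsto ψ).comp h
  · exact fun h => ((coords n).symm.continuous.tendsto (fun ℓ => ψ ℓ)).comp h

theorem hasDerivAtZero_graph_iff {F : ℝ → L2Graph n} {ψ : L2Graph n} :
    HasDerivAtZero F ψ ↔ ∀ ℓ, HasDerivAtZero (fun i => F i ℓ) (ψ ℓ) :=
  tendsto_graph_iff

end Graph

/-! ### The Hamiltonians in terms of the symmetric and antisymmetric parts -/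

theorem HasTrace.unique {f : L2Half} {a b : ℂ} (ha : HasTrace f a) (hb : HasTrace f b) :
    a = b := by
  obtain ⟨u, hu, hfu, rfl⟩ := ha
  obtain ⟨v, hv, hfv, rfl⟩ := hb
  have h : u =ᵐ[volume.restrict (Ici (0 : ℝ))] v := by
    rw [Measure.restrict_congr_set Ioi_ae_eq_Ici.symm]
    exact hfu.symm.trans hfv
  exact Measure.eqOn_of_ae_eq h hu hv (by simp) self_mem_Ici

theorem HasTrace.sub {f g : L2Half} {a b : ℂ} (hf : HasTrace f a) (hg : HasTrace g b) :
    HasTrace (f - g) (a - b) := by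
  simpa [sub_eq_add_neg] using hf.add (hg.smul (-1))

theorem IsWeakDeriv.sub {f g f' g' : L2Half} (hf : IsWeakDeriv f f') (hg : IsWeakDeriv g g') :
    IsWeakDeriv (f - g) (f' - g') := by
  simpa [sub_eq_add_neg] using hf.add (hg.smul (-1))

theorem HasTrace.sum {n : ℕ} {f : Fin n → L2Half} {a : Fin n → ℂ} (h : ∀ ℓ, HasTrace (f ℓ) (a ℓ)) :
    HasTrace (∑ ℓ, f ℓ) (∑ ℓ, a ℓ) := by
  have key : ∀ s : Finset (Fin n), HasTrace (∑ ℓ ∈ s, f ℓ) (∑ ℓ ∈ s, a ℓ) := by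
    intro s
    induction s using Finset.induction_on with
    | empty => exact HasTrace.zero
    | insert i s hi ih =>
      rw [Finset.sum_insert hi, Finset.sum_insert hi]
      exact (h i).add ih
  exact key _

theorem IsWeakDeriv.sum {n : ℕ} {f g : Fin n → L2Half} (h : ∀ ℓ, IsWeakDeriv (f ℓ) (g ℓ)) :
    IsWeakDeriv (∑ ℓ, f ℓ) (∑ ℓ, g ℓ) := by
  have key : ∀ s : Finset (Fin n), IsWeakDeriv (∑ ℓ ∈ s, f ℓ) (∑ ℓ ∈ s, g ℓ) := by
    intro s
    induction s using Finset.induction_on with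
    | empty => exact IsWeakDeriv.zero
    | insert i s hi ih =>
      rw [Finset.sum_insert hi, Finset.sum_insert hi]
      exact (h i).add ih
  exact key _

/-- `f₂` is the second derivative of `f`, and `f` vanishes at `0`. -/
def IsDirichletDeriv₂ (f f₂ : L2Half) : Prop :=
  ∃ (f₁ : L2Half) (b : ℂ), IsWeakDeriv f f₁ ∧ IsWeakDeriv f₁ f₂ ∧ HasTrace f 0 ∧ HasTrace f₁ b

/-- `f₂` is the second derivative of `f`, and the first derivative vanishes at `0`. -/
def IsNeumannDeriv₂ (f f₂ : L2Half) : Prop :=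
  ∃ (f₁ : L2Half) (a : ℂ), IsWeakDeriv f f₁ ∧ IsWeakDeriv f₁ f₂ ∧ HasTrace f a ∧ HasTrace f₁ 0

theorem IsDirichletDeriv₂.add {f f₂ g g₂ : L2Half} (hf : IsDirichletDeriv₂ f f₂)
    (hg : IsDirichletDeriv₂ g g₂) : IsDirichletDeriv₂ (f + g) (f₂ + g₂) := by
  obtain ⟨f₁, a, h1, h2, h3, h4⟩ := hf
  obtain ⟨g₁, b, k1, k2, k3, k4⟩ := hg
  exact ⟨_, _, h1.add k1, h2.add k2, by simpa using h3.add k3, h4.add k4⟩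

theorem IsDirichletDeriv₂.smul {f f₂ : L2Half} (c : ℂ) (hf : IsDirichletDeriv₂ f f₂) :
    IsDirichletDeriv₂ (c • f) (c • f₂) := by
  obtain ⟨f₁, a, h1, h2, h3, h4⟩ := hf
  exact ⟨_, _, h1.smul c, h2.smul c, by simpa using h3.smul c, h4.smul c⟩

theorem IsDirichletDeriv₂.sum {n : ℕ} {f f₂ : Fin n → L2Half}
    (h : ∀ ℓ, IsDirichletDeriv₂ (f ℓ) (f₂ ℓ)) : IsDirichletDeriv₂ (∑ ℓ, f ℓ) (∑ ℓ, f₂ ℓ) := by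
  choose f₁ b h1 h2 h3 h4 using h
  exact ⟨_, _, IsWeakDeriv.sum h1, IsWeakDeriv.sum h2, by simpa using HasTrace.sum h3,
    HasTrace.sum h4⟩

section Hamiltonians

variable {n : ℕ} {ħ m : ℝ}

theorem neg_sq_div_ne_zero (hħ : 0 < ħ) (hm : 0 < m) : (-(ħ ^ 2 / (2 * m) : ℝ) : ℂ) ≠ 0 := by
  have h : (-(ħ ^ 2 / (2 * m)) : ℝ) ≠ 0 := neg_ne_zero.2 (by positivity)
  exact_mod_cast h

theorem symProj_apply_add_antiProj_apply (ψ : L2Graph n) (ℓ : Fin n) :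
    symProj n ψ ℓ + antiProj n ψ ℓ = ψ ℓ := by
  rw [symProj_apply, antiProj_apply, add_sub_cancel]

/-- The Dirichlet Hamiltonian acts edge by edge. -/
theorem dirichletHamiltonian_graph_iff (hħ : 0 < ħ) (hm : 0 < m) {ψ ζ : L2Graph n} :
    (ψ, (-(ħ ^ 2 / (2 * m) : ℝ) : ℂ) • ζ) ∈ (dirichletHamiltonian n ħ m).graph ↔
      ∀ ℓ, IsDirichletDeriv₂ (ψ ℓ) (ζ ℓ) := by
  rw [dirichletHamiltonian, hamiltonian_graph]
  constructor
  · rintro ⟨ψ', ψ'', a, b, h1, h2, h3, h4, h5, h6⟩ ℓ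
    have e : ζ = ψ'' := smul_right_injective _ (neg_sq_div_ne_zero hħ hm) h6
    have h5' : a ℓ = 0 := h5 ℓ
    exact ⟨ψ' ℓ, b ℓ, h1 ℓ, e ▸ h2 ℓ, h5' ▸ h3 ℓ, h4 ℓ⟩
  · intro h
    choose f₁ b h1 h2 h3 h4 using h
    exact ⟨WithLp.toLp 2 f₁, ζ, 0, b, h1, h2, h3, h4, fun _ => rfl, rfl⟩

/-- The Kirchhoff Hamiltonian is the Neumann operator on the symmetric part and the Dirichlet
operator on the antisymmetric part. -/
theorem kirchhoffHamiltonian_graph_iff (hn : 0 < n) (hħ : 0 < ħ) (hm : 0 < m) {ψ ζ : L2Graph n} :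
    (ψ, (-(ħ ^ 2 / (2 * m) : ℝ) : ℂ) • ζ) ∈ (kirchhoffHamiltonian n ħ m).graph ↔
      (∀ ℓ, IsNeumannDeriv₂ (symProj n ψ ℓ) (symProj n ζ ℓ)) ∧
        ∀ ℓ, IsDirichletDeriv₂ (antiProj n ψ ℓ) (antiProj n ζ ℓ) := by
  have hn' : (n : ℂ) ≠ 0 := by exact_mod_cast hn.ne'
  rw [kirchhoffHamiltonian, hamiltonian_graph]
  constructor
  · rintro ⟨ψ', ψ'', a, b, h1, h2, h3, h4, ⟨h5, h5'⟩, h6⟩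
    have e : ζ = ψ'' := smul_right_injective _ (neg_sq_div_ne_zero hħ hm) h6
    subst e
    simp only at h5 h5' h1 h3
    have w1 := (IsWeakDeriv.sum h1).smul (1 / (n : ℂ))
    have w2 := (IsWeakDeriv.sum h2).smul (1 / (n : ℂ))
    have t1 := (HasTrace.sum h3).smul (1 / (n : ℂ))
    have t2 := (HasTrace.sum h4).smul (1 / (n : ℂ))
    rw [h5', smul_zero] at t2
    refine ⟨fun ℓ => ?_, fun ℓ => ?_⟩
    · rw [symProj_apply, symProj_apply]
      exact ⟨_, _, w1, w2, t1, t2⟩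
    · rw [antiProj_apply, antiProj_apply]
      have ha : a ℓ - (1 / (n : ℂ)) • ∑ ℓ', a ℓ' = 0 := by
        rw [Finset.sum_congr rfl fun ℓ' _ => h5 ℓ' ℓ, Finset.sum_const, Finset.card_univ,
          Fintype.card_fin, nsmul_eq_mul, smul_eq_mul, one_div, inv_mul_cancel_left₀ hn', sub_self]
      exact ⟨_, _, (h1 ℓ).sub w1, (h2 ℓ).sub w2, ha ▸ (h3 ℓ).sub t1, (h4 ℓ).sub t2⟩
  · rintro ⟨h, k⟩
    choose f₁ a h1 h2 h3 h4 using h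
    choose g₁ b k1 k2 k3 k4 using k
    -- the antisymmetric part sums to zero, and so do its derivative and the traces of the latter
    have hanti : ∑ ℓ, antiProj n ψ ℓ = 0 := by
      simp only [antiProj_apply, Finset.sum_sub_distrib, Finset.sum_const, Finset.card_univ,
        Fintype.card_fin]
      rw [← Nat.cast_smul_eq_nsmul ℂ, smul_smul, mul_one_div_cancel hn', one_smul, sub_self]
    have hg : ∑ ℓ, g₁ ℓ = 0 := by
      have := IsWeakDeriv.sum k1
      rw [hanti] at this
      exact this.unique_zero
    have hb : ∑ ℓ, b ℓ = 0 := by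
      have := HasTrace.sum k4
      rw [hg] at this
      exact this.unique HasTrace.zero
    have ha : ∀ ℓ ℓ', a ℓ = a ℓ' := by
      intro ℓ ℓ'
      have e1 := h3 ℓ
      have e2 := h3 ℓ'
      rw [symProj_apply] at e1 e2
      exact e1.unique e2
    refine ⟨WithLp.toLp 2 fun ℓ => f₁ ℓ + g₁ ℓ, ζ, fun ℓ => a ℓ + 0, fun ℓ => 0 + b ℓ,
      fun ℓ => ?_, fun ℓ => ?_, fun ℓ => ?_, fun ℓ => (h4 ℓ).add (k4 ℓ), ⟨?_, ?_⟩, rfl⟩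
    · exact symProj_apply_add_antiProj_apply ψ ℓ ▸ (h1 ℓ).add (k1 ℓ)
    · exact symProj_apply_add_antiProj_apply ζ ℓ ▸ (h2 ℓ).add (k2 ℓ)
    · exact symProj_apply_add_antiProj_apply ψ ℓ ▸ (h3 ℓ).add (k3 ℓ)
    · intro ℓ ℓ'
      simp only [add_zero]
      exact ha ℓ ℓ'
    · simpa using hb

theorem forall_isDirichletDeriv₂_iff {ψ ζ : L2Graph n} :
    (∀ ℓ, IsDirichletDeriv₂ (ψ ℓ) (ζ ℓ)) ↔
      (∀ ℓ, IsDirichletDeriv₂ (symProj n ψ ℓ) (symProj n ζ ℓ)) ∧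
        ∀ ℓ, IsDirichletDeriv₂ (antiProj n ψ ℓ) (antiProj n ζ ℓ) := by
  constructor
  · intro h
    have hs := (IsDirichletDeriv₂.sum h).smul (1 / (n : ℂ))
    refine ⟨fun ℓ => ?_, fun ℓ => ?_⟩
    · rwa [symProj_apply, symProj_apply]
    · rw [antiProj_apply, antiProj_apply]
      simpa [sub_eq_add_neg] using (h ℓ).add (hs.smul (-1))
  · rintro ⟨h, k⟩ ℓ
    rw [← symProj_apply_add_antiProj_apply ψ, ← symProj_apply_add_antiProj_apply ζ]
    exact (h ℓ).add (k ℓ)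

/-! ### The unitary groups on the graph -/

/-- A unitary group on the graph built from two half-line groups, acting on the symmetric and on the
antisymmetric part. -/
theorem isUnitaryGroup_blockOp (hn : 0 < n) (hħ : 0 < ħ) (hm : 0 < m) {κ ρ : ℝ → ℝ}
    (hκ : IsPlancherelKernel κ) (hρ : IsPlancherelKernel ρ) {H : L2Graph n →ₗ.[ℂ] L2Graph n}
    (hH : ∀ ψ ζ : L2Graph n, (ψ, (-(ħ ^ 2 / (2 * m) : ℝ) : ℂ) • ζ) ∈ H.graph ↔
      (∀ ℓ, hκ.op (symProj n ζ ℓ) =ᵐ[halfLine]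
        fun k => -((k : ℂ) ^ 2 * hκ.op (symProj n ψ ℓ) k)) ∧
      ∀ ℓ, hρ.op (antiProj n ζ ℓ) =ᵐ[halfLine]
        fun k => -((k : ℂ) ^ 2 * hρ.op (antiProj n ψ ℓ) k)) :
    IsUnitaryGroup ħ H
      (fun t => blockOp n (hκ.group (ħ / (2 * m)) t) (hρ.group (ħ / (2 * m)) t)) := by
  set c := ħ / (2 * m) with hc
  have hc0 : 0 < c := by positivity
  set U : ℝ → L2Graph n →L[ℂ] L2Graph n := fun t => blockOp n (hκ.group c t) (hρ.group c t)
  have hadd : ∀ s t, U (s + t) = U s * U t := fun s t => by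
    simp only [U]
    rw [hκ.group_add, hρ.group_add, blockOp_mul hn]
  have hzero : U 0 = 1 := by
    simp only [U]
    rw [hκ.group_zero, hρ.group_zero, blockOp_one]
  have hstar : ∀ t, star (U t) = U (-t) := fun t => by
    simp only [U]
    rw [star_blockOp, hκ.star_group, hρ.star_group]
  refine ⟨fun t => ?_, hzero, hadd, fun ψ => ?_, fun ψ η => ?_⟩
  · rw [Unitary.mem_iff, hstar, ← hadd, ← hadd, neg_add_cancel, add_neg_cancel, hzero]
    exact ⟨rfl, rfl⟩
  · have h : ∀ {κ : ℝ → ℝ} (hκ : IsPlancherelKernel κ) (φ : L2Graph n),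
        Continuous fun t => directSum n (hκ.group c t) φ := by
      intro κ hκ φ
      exact (coords n).symm.continuous.comp
        (continuous_pi fun ℓ => hκ.continuous_group c (φ ℓ))
    exact ((symProj n).continuous.comp (h hκ ψ)).add ((antiProj n).continuous.comp (h hρ ψ))
  · obtain ⟨ζ, rfl⟩ : ∃ ζ : L2Graph n, η = (-(ħ ^ 2 / (2 * m) : ℝ) : ℂ) • ζ :=
      ⟨(-(ħ ^ 2 / (2 * m) : ℝ) : ℂ)⁻¹ • η, (smul_inv_smul₀ (neg_sq_div_ne_zero hħ hm) η).symm⟩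
    have hξ : (-(Complex.I / (ħ : ℂ))) • (-(ħ ^ 2 / (2 * m) : ℝ) : ℂ) • ζ
        = (Complex.I * c) • ζ := by
      rw [smul_smul]
      congr 1
      have h1 : (ħ : ℂ) ≠ 0 := by exact_mod_cast hħ.ne'
      have h2 : (m : ℂ) ≠ 0 := by exact_mod_cast hm.ne'
      rw [hc]
      push_cast
      field_simp
    rw [hH, hasDerivAt_iff_hasDerivAtZero, hξ]
    -- the projections commute with the group and with differentiation
    have hsym : ∀ t, symProj n (U t ψ) = directSum n (hκ.group c t) (symProj n ψ) := fun t => by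
      change (symProj n * (symProj n * directSum n (hκ.group c t)
        + antiProj n * directSum n (hρ.group c t))) ψ
        = (directSum n (hκ.group c t) * symProj n) ψ
      rw [mul_add, ← mul_assoc, ← mul_assoc, symProj_mul_self hn, symProj_mul_antiProj hn, zero_mul,
        add_zero, (commute_symProj _).eq]
    have hanti : ∀ t, antiProj n (U t ψ) = directSum n (hρ.group c t) (antiProj n ψ) := fun t => by
      change (antiProj n * (symProj n * directSum n (hκ.group c t)
        + antiProj n * directSum n (hρ.group c t))) ψ
        = (directSum n (hρ.group c t) * antiProj n) ψ
      rw [mul_add, ← mul_assoc, ← mul_assoc, antiProj_mul_self hn, antiProj_mul_symProj hn,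
        zero_mul, zero_add, (commute_antiProj _).eq]
    have hsplit : HasDerivAtZero (fun t => U t ψ) ((Complex.I * c) • ζ) ↔
        HasDerivAtZero (fun t => directSum n (hκ.group c t) (symProj n ψ))
          ((Complex.I * c) • symProj n ζ) ∧
        HasDerivAtZero (fun t => directSum n (hρ.group c t) (antiProj n ψ))
          ((Complex.I * c) • antiProj n ζ) := by
      constructor
      · intro h
        have e1 := h.map (symProj n)
        have e2 := h.map (antiProj n)
        rw [map_smul] at e1 e2
        simp only [hsym] at e1
        simp only [hanti] at e2
        exact ⟨e1, e2⟩
      · rintro ⟨h1, h2⟩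
        have hid : ∀ φ : L2Graph n, symProj n φ + antiProj n φ = φ := fun φ =>
          congrArg (fun A : L2Graph n →L[ℂ] L2Graph n => A φ) symProj_add_antiProj
        have h3 := h1.add h2
        rw [← smul_add, hid] at h3
        simp only [← hsym, ← hanti, hid] at h3
        exact h3
    rw [hsplit, hasDerivAtZero_graph_iff, hasDerivAtZero_graph_iff]
    refine and_congr (forall_congr' fun ℓ => ?_) (forall_congr' fun ℓ => ?_)
    · exact (hκ.hasDerivAtZero_group_iff hc0.ne').symm
    · exact (hρ.hasDerivAtZero_group_iff hc0.ne').symm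

theorem isUnitaryGroup_kirchhoff (hn : 0 < n) (hħ : 0 < ħ) (hm : 0 < m) :
    IsUnitaryGroup ħ (kirchhoffHamiltonian n ħ m) fun t =>
      blockOp n (isPlancherelKernel_cos.group (ħ / (2 * m)) t)
        (isPlancherelKernel_sin.group (ħ / (2 * m)) t) := by
  refine isUnitaryGroup_blockOp hn hħ hm _ _ fun ψ ζ => ?_
  rw [kirchhoffHamiltonian_graph_iff hn hħ hm]
  exact and_congr (forall_congr' fun ℓ => neumann_iff) (forall_congr' fun ℓ => dirichlet_iff)

theorem isUnitaryGroup_dirichlet (hn : 0 < n) (hħ : 0 < ħ) (hm : 0 < m) :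
    IsUnitaryGroup ħ (dirichletHamiltonian n ħ m) fun t =>
      blockOp n (isPlancherelKernel_sin.group (ħ / (2 * m)) t)
        (isPlancherelKernel_sin.group (ħ / (2 * m)) t) := by
  refine isUnitaryGroup_blockOp hn hħ hm _ _ fun ψ ζ => ?_
  rw [dirichletHamiltonian_graph_iff hħ hm, forall_isDirichletDeriv₂_iff]
  exact and_congr (forall_congr' fun ℓ => dirichlet_iff) (forall_congr' fun ℓ => dirichlet_iff)

/-! ### The wave operators -/

/-- The wave operators, for `t = σ s → ±∞`: on the antisymmetric part the two groups agree, on the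
symmetric part the limit is the one on the half-line. -/
theorem tendsto_blockOp (hn : 0 < n) {c : ℝ} (hc : 0 < c) {σ : ℝ} (hσ : σ = 1 ∨ σ = -1)
    (ψ : L2Graph n) :
    Tendsto (fun s => blockOp n (isPlancherelKernel_cos.group c (-(σ * s)))
        (isPlancherelKernel_sin.group c (-(σ * s)))
        (blockOp n (isPlancherelKernel_sin.group c (σ * s))
          (isPlancherelKernel_sin.group c (σ * s)) ψ))
      atTop (𝓝 (blockOp n ((σ : ℂ) • cosAdjSin) 1 ψ)) := by
  have e : ∀ s, blockOp n (isPlancherelKernel_cos.group c (-(σ * s)))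
      (isPlancherelKernel_sin.group c (-(σ * s)))
      (blockOp n (isPlancherelKernel_sin.group c (σ * s))
        (isPlancherelKernel_sin.group c (σ * s)) ψ) =
      symProj n (directSum n (isPlancherelKernel_cos.group c (-(σ * s)) *
        isPlancherelKernel_sin.group c (σ * s)) ψ) + antiProj n ψ := by
    intro s
    rw [← mul_apply_eq_comp, blockOp_mul hn, ← isPlancherelKernel_sin.group_add, neg_add_cancel,
      isPlancherelKernel_sin.group_zero, blockOp, directSum_one, mul_one]
    rfl
  have e' : blockOp n ((σ : ℂ) • cosAdjSin) 1 ψ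
      = symProj n (directSum n ((σ : ℂ) • cosAdjSin) ψ) + antiProj n ψ := by
    rw [blockOp, directSum_one, mul_one]
    rfl
  simp only [e]
  rw [e']
  refine Tendsto.add ?_ tendsto_const_nhds
  refine ((symProj n).continuous.tendsto _).comp (tendsto_graph_iff.2 fun ℓ => ?_)
  exact tendsto_neumann_dirichlet hc hσ (ψ ℓ)

end Hamiltonians

end StarGraph

theorem proposition2p1 (n : ℕ) (hn : 0 < n) (ħ m : ℝ) (hħ : 0 < ħ) (hm : 0 < m) :
    -- the objects entering the formulas are well defined
    (∃! F, IsSineTransform F) ∧ (∃! F, IsCosineTransform F) ∧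
    (∃! U, IsUnitaryGroup ħ (kirchhoffHamiltonian n ħ m) U) ∧
    (∃! U, IsUnitaryGroup ħ (dirichletHamiltonian n ħ m) U) ∧
    -- the wave operators
    IsWaveOperator ħ (kirchhoffHamiltonian n ħ m) (dirichletHamiltonian n ħ m) atTop
      ((1 / 2 : ℂ) • directSum n (1 + cosAdjSin) +
        (1 / 2 : ℂ) • (vertexOperator n ∘L directSum n (1 - cosAdjSin))) ∧
    IsWaveOperator ħ (kirchhoffHamiltonian n ħ m) (dirichletHamiltonian n ħ m) atBot
      ((1 / 2 : ℂ) • directSum n (1 - cosAdjSin) +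
        (1 / 2 : ℂ) • (vertexOperator n ∘L directSum n (1 + cosAdjSin))) ∧
    -- the scattering operator
    IsScatteringOperator ħ (kirchhoffHamiltonian n ħ m) (dirichletHamiltonian n ħ m)
      (vertexOperator n) := by
  have hK := isUnitaryGroup_kirchhoff hn hħ hm
  have hD := isUnitaryGroup_dirichlet hn hħ hm
  have hc : 0 < ħ / (2 * m) := by positivity
  have hplus : IsWaveOperator ħ (kirchhoffHamiltonian n ħ m) (dirichletHamiltonian n ħ m) atTop
      (blockOp n cosAdjSin 1) := by
    intro ψ
    rw [hK.unitaryGroup_eq hħ.ne', hD.unitaryGroup_eq hħ.ne']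
    have h := tendsto_blockOp hn hc (σ := 1) (Or.inl rfl) ψ
    simpa only [one_mul, Complex.ofReal_one, one_smul] using h
  have hminus : IsWaveOperator ħ (kirchhoffHamiltonian n ħ m) (dirichletHamiltonian n ħ m) atBot
      (blockOp n (-cosAdjSin) 1) := by
    intro ψ
    rw [hK.unitaryGroup_eq hħ.ne', hD.unitaryGroup_eq hħ.ne']
    have h := (tendsto_blockOp hn hc (σ := -1) (Or.inr rfl) ψ).comp tendsto_neg_atBot_atTop
    simpa only [Function.comp_def, neg_mul, one_mul, neg_neg, Complex.ofReal_neg,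
      Complex.ofReal_one, neg_smul, one_smul] using h
  refine ⟨⟨_, (isSineTransform_iff _).2 rfl, fun F hF => (isSineTransform_iff F).1 hF⟩,
    ⟨_, (isCosineTransform_iff _).2 rfl, fun F hF => (isCosineTransform_iff F).1 hF⟩,
    hK.existsUnique hħ.ne', hD.existsUnique hħ.ne', ?_, ?_, _, _, hplus, hminus, ?_⟩
  · rw [← blockOp_eq_half]
    exact hplus
  · have h := blockOp_eq_half (n := n) (-cosAdjSin)
    rw [sub_neg_eq_add, ← sub_eq_add_neg] at h
    rw [← h]
    exact hminus
  · rw [← ContinuousLinearMap.star_eq_adjoint, star_blockOp, star_one]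
    have h := blockOp_mul hn (star cosAdjSin) 1 (-cosAdjSin) 1
    have e : star cosAdjSin * -cosAdjSin = -1 := by
      rw [← star_cosAdjSin_mul]
      exact mul_neg _ _
    rw [e, mul_one, blockOp_neg_one_one] at h
    exact h.symm
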